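/- Let $M$ be a compact, simply connected (in particular connected) smooth Riemannian manifold without boundary, with nonnegative sectional curvature, and let $\mathsf G$ be a compact connected Lie group acting smoothly and isometrically on $M$. Let $\pi : M \to M^* = M/\mathsf G$ be the quotient map, where $M^*$ carries the distance of orbits, and is thus a nonnegatively curved Alexandrov space; suppose that its boundary is nonempty. A closed subset $E$ of an Alexandrov space $A$ is called *extremal* if for every $q \in A \setminus E$ and every $p \in E$ at which the restriction to $E$ of the distance function $d_q$ has a local minimum, $p$ is a critical point of $d_q$, i.e. $\limsup_{x \to p} (d(q,x) - d(q,p))/d(p,x) \le 0$. For $x \in A$ let $\mathrm{Ext}(x)$ be the smallest extremal subset that contains $x$; the sets $E = \mathrm{Ext}(x)$ are called *primitive*, and the dimension of such an $E$ is the dimension of the topological manifold $\{y \in E \mid \mathrm{Ext}(y) = E\}$. A *boundary stratum* of $A$ is any union of primitive extremal subsets of codimension $1$ in $A$, and the boundary of $A$ is the union of all of them. Let $B$ be a nonempty, connected boundary stratum of $M^*$ such that $\pi^{-1}(B)$ is a smooth submanifold of $M$, and let $N \subseteq M$ be a closed smooth $\mathsf G$-invariant submanifold without boundary such that $M \setminus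 \pi^{-1}(B)$ is $\mathsf G$-equivariantly diffeomorphic to the normal bundle of $N$ in $M$. Then $N$ has codimension at least $2$ in $M$ (each of its connected components has codimension at least $2$). -/

import Mathlib

open Set Filter Topology Bundle
open scoped Manifold ContDiff

/-! ### Sectional curvature of a Riemannian manifold, in charts -/

section Curvature

variable {n : ℕ} {M : Type*} [MetricSpace M] [ChartedSpace (EuclideanSpace ℝ (Fin n)) M]
  [RiemannianBundle (fun x : M => TangentSpace (𝓡 n) x)]

/-- The matrix `g_{ij}(y)` of the Riemannian metric in the preferred chart around `x₀`,
at the point with coordinates `y`. -/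
noncomputable def metricMatrix (x₀ : M) (y : EuclideanSpace ℝ (Fin n)) :
    Matrix (Fin n) (Fin n) ℝ := fun i j =>
  inner ℝ
    (mfderiv (𝓡 n) (𝓡 n) (extChartAt (𝓡 n) x₀).symm y (EuclideanSpace.single i (1 : ℝ)))
    (mfderiv (𝓡 n) (𝓡 n) (extChartAt (𝓡 n) x₀).symm y (EuclideanSpace.single j (1 : ℝ)))

/-- The `i`-th partial derivative of a function of the coordinates. -/
noncomputable def coordDeriv (i : Fin n) (f : EuclideanSpace ℝ (Fin n) → ℝ)
    (y : EuclideanSpace ℝ (Fin n)) : ℝ :=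
  fderiv ℝ f y (EuclideanSpace.single i (1 : ℝ))

/-- The Christoffel symbol `Γ^l_{ij}` of the Levi-Civita connection:
`½ ∑ₘ g^{lm} (∂ᵢ g_{jm} + ∂ⱼ g_{im} - ∂ₘ g_{ij})`. -/
noncomputable def christoffel (x₀ : M) (l i j : Fin n) (y : EuclideanSpace ℝ (Fin n)) : ℝ :=
  (1 / 2 : ℝ) * ∑ m, (metricMatrix x₀ y)⁻¹ l m *
    (coordDeriv i (fun z => metricMatrix x₀ z j m) y
      + coordDeriv j (fun z => metricMatrix x₀ z i m) y
      - coordDeriv m (fun z => metricMatrix x₀ z i j) y)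

/-- The component `R^l_{kij}` of the curvature tensor: `R(∂ᵢ, ∂ⱼ) ∂ₖ = ∑ₗ R^l_{kij} ∂ₗ`, where
`R(X, Y) Z = ∇_X ∇_Y Z - ∇_Y ∇_X Z - ∇_{[X, Y]} Z`. -/
noncomputable def curvatureCoeff (x₀ : M) (l k i j : Fin n) (y : EuclideanSpace ℝ (Fin n)) : ℝ :=
  coordDeriv i (christoffel x₀ l j k) y - coordDeriv j (christoffel x₀ l i k) y
    + ∑ m, (christoffel x₀ l i m y * christoffel x₀ m j k y
      - christoffel x₀ l j m y * christoffel x₀ m i k y)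

/-- The value `⟨R(u, v) v, u⟩` for tangent vectors with coordinates `u` and `v`. If `u`, `v` are
linearly independent, then this is the sectional curvature of the plane that they span times the
positive number `|u|² |v|² - ⟨u, v⟩²`; otherwise it is zero. -/
noncomputable def sectionalNumerator (x₀ : M) (y u v : EuclideanSpace ℝ (Fin n)) : ℝ :=
  ∑ i, ∑ j, ∑ k, ∑ l, ∑ m,
    metricMatrix x₀ y l m * curvatureCoeff x₀ l k i j y * u i * v j * v k * u m

end Curvature

/-- All sectional curvatures of the Riemannian manifold `M` are nonnegative. -/
def NonnegativelyCurved (n : ℕ) (M : Type*) [MetricSpace M]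
    [ChartedSpace (EuclideanSpace ℝ (Fin n)) M]
    [RiemannianBundle (fun x : M => TangentSpace (𝓡 n) x)] : Prop :=
  ∀ x₀ : M, ∀ y ∈ (extChartAt (𝓡 n) x₀).target, ∀ u v : EuclideanSpace ℝ (Fin n),
    0 ≤ sectionalNumerator x₀ y u v

/-! ### The orbit space with the distance of orbits -/

/-- The orbit space `M / G`. -/
def OrbitSpace (G M : Type*) [Group G] [MulAction G M] : Type _ :=
  MulAction.orbitRel.Quotient G M

namespace OrbitSpace

/-- The quotient map `π : M → M / G`. -/
def proj (G : Type*) {M : Type*} [Group G] [MulAction G M] (x : M) : OrbitSpace G M :=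
  Quotient.mk (MulAction.orbitRel G M) x

variable {G M : Type*} [Group G] [MetricSpace M] [MulAction G M] [IsIsometricSMul G M]

theorem infDist_smul_left (g : G) (x y : M) :
    Metric.infDist (g • x) (MulAction.orbit G y) = Metric.infDist x (MulAction.orbit G y) := by
  have h : (fun z : M => g • z) '' MulAction.orbit G y = MulAction.orbit G y :=
    MulAction.smul_orbit g y
  conv_lhs => rw [← h]
  exact Metric.infDist_image (isometry_smul M g)

/-- The distance of two points of the orbit space is the distance of the orbits,
`d (π x) (π y) = inf {d x (g y) | g ∈ G}`. -/
noncomputable instance : Dist (OrbitSpace G M) where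
  dist a b := Quotient.liftOn₂ a b (fun x y => Metric.infDist x (MulAction.orbit G y)) (by
    intro x y x' y' hx hy
    obtain ⟨g, rfl⟩ := (MulAction.orbitRel_apply.1 hx)
    have hy' : MulAction.orbit G y = MulAction.orbit G y' := MulAction.orbit_eq_iff.2 hy
    change Metric.infDist (g • x') _ = _
    rw [hy', infDist_smul_left])

theorem dist_proj (x y : M) :
    dist (proj G x) (proj G y) = Metric.infDist x (MulAction.orbit G y) := rfl

theorem dist_proj_le (x y : M) (g : G) : dist (proj G x) (proj G y) ≤ dist x (g • y) :=
  Metric.infDist_le_dist_of_mem (MulAction.mem_orbit y g)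

variable [TopologicalSpace G] [CompactSpace G] [ContinuousSMul G M]

theorem exists_dist_proj_eq (x y : M) :
    ∃ g : G, dist (proj G x) (proj G y) = dist x (g • y) := by
  have hc : IsCompact (MulAction.orbit G y) :=
    isCompact_range (continuous_id.smul continuous_const)
  obtain ⟨z, ⟨g, rfl⟩, hz⟩ := hc.exists_infDist_eq_dist (MulAction.nonempty_orbit y) x
  exact ⟨g, hz⟩

noncomputable instance : MetricSpace (OrbitSpace G M) where
  dist_self a := by
    obtain ⟨x, rfl⟩ := Quotient.exists_rep a
    exact Metric.infDist_zero_of_mem (MulAction.mem_orbit_self x)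
  dist_comm a b := by
    have key : ∀ x y : M, dist (proj G x) (proj G y) ≤ dist (proj G y) (proj G x) := by
      intro x y
      obtain ⟨g, hg⟩ := exists_dist_proj_eq (G := G) y x
      refine (dist_proj_le x y g⁻¹).trans (le_of_eq ?_)
      rw [hg, ← dist_smul g x (g⁻¹ • y), smul_inv_smul, dist_comm]
    obtain ⟨x, rfl⟩ := Quotient.exists_rep a
    obtain ⟨y, rfl⟩ := Quotient.exists_rep b
    exact le_antisymm (key x y) (key y x)
  dist_triangle a b c := by
    obtain ⟨x, rfl⟩ := Quotient.exists_rep a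
    obtain ⟨y, rfl⟩ := Quotient.exists_rep b
    obtain ⟨z, rfl⟩ := Quotient.exists_rep c
    change dist (proj G x) (proj G z) ≤ dist (proj G x) (proj G y) + dist (proj G y) (proj G z)
    obtain ⟨g, hg⟩ := exists_dist_proj_eq (G := G) x y
    obtain ⟨h, hh⟩ := exists_dist_proj_eq (G := G) y z
    calc dist (proj G x) (proj G z) ≤ dist x ((g * h) • z) := dist_proj_le x z (g * h)
      _ ≤ dist x (g • y) + dist (g • y) ((g * h) • z) := dist_triangle _ _ _
      _ = _ := by rw [hg, hh, mul_smul, dist_smul]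
  eq_of_dist_eq_zero := by
    intro a b
    obtain ⟨x, rfl⟩ := Quotient.exists_rep a
    obtain ⟨y, rfl⟩ := Quotient.exists_rep b
    intro h
    obtain ⟨g, hg⟩ := exists_dist_proj_eq (G := G) x y
    have h' : dist (proj G x) (proj G y) = 0 := h
    rw [h'] at hg
    have hx : x = g • y := dist_eq_zero.1 hg.symm
    exact Quotient.sound (s := MulAction.orbitRel G M)
      (MulAction.orbitRel_apply.2 ⟨g, hx.symm⟩)

end OrbitSpace

/-! ### Extremal subsets and boundary strata of an Alexandrov space -/

section Extremal

variable {A : Type*} [MetricSpace A]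

/-- The point `p` is critical for the distance function to `q`: the distance to `q` has
nonpositive derivative at `p` in every direction, i.e.
`limsup_{x → p} (d q x - d q p) / d p x ≤ 0`. -/
def IsCriticalFor (q p : A) : Prop :=
  ∀ ε > 0, ∀ᶠ x in 𝓝 p, dist q x ≤ dist q p + ε * dist p x

/-- A closed subset `E` is extremal if, whenever `q ∉ E` and the distance function to `q`
restricted to `E` has a local minimum at `p ∈ E`, the point `p` is critical for `q`. -/
def IsExtremal (E : Set A) : Prop :=
  IsClosed E ∧ ∀ q ∉ E, ∀ p ∈ E, IsLocalMinOn (fun x => dist q x) E p → IsCriticalFor q p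

/-- The smallest extremal subset `Ext(x)` that contains `x`. -/
def extremalHull (x : A) : Set A := ⋂₀ {E | IsExtremal E ∧ x ∈ E}

/-- A primitive extremal subset: a set of the form `Ext(x)`. -/
def IsPrimitiveExtremal (E : Set A) : Prop := ∃ x, E = extremalHull x

/-- The main part of a primitive extremal subset `E`: the points `y ∈ E` with `Ext(y) = E`. -/
def extremalMainPart (E : Set A) : Set A := {y | y ∈ E ∧ extremalHull y = E}

/-- `E` is a primitive extremal subset of codimension one: its main part is a topological
manifold of dimension `m`, and the (Hausdorff) dimension of the Alexandrov space is `m + 1`. -/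
def IsCodimOneExtremal (E : Set A) : Prop :=
  IsPrimitiveExtremal E ∧ ∃ m : ℕ,
    Nonempty (ChartedSpace (EuclideanSpace ℝ (Fin m)) (extremalMainPart E)) ∧
      dimH (univ : Set A) = m + 1

/-- A boundary stratum: any union of primitive extremal subsets of codimension one. -/
def IsBoundaryStratum (B : Set A) : Prop :=
  ∃ F : Set (Set A), (∀ E ∈ F, IsCodimOneExtremal E) ∧ B = ⋃₀ F

variable (A) in
/-- The boundary `∂A`: the union of all primitive extremal subsets of codimension one. -/
def alexandrovBoundary : Set A := ⋃₀ {E : Set A | IsCodimOneExtremal E}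

end Extremal

/-! ### Submanifolds and normal bundles -/

section Submanifold

variable {n : ℕ} {M : Type*} [MetricSpace M] [ChartedSpace (EuclideanSpace ℝ (Fin n)) M]

/-- Near its point `p`, the set `N` is a `d`-dimensional embedded smooth submanifold of `M`: some
smooth chart of `M` around `p` takes `N` to a `d`-dimensional linear subspace. -/
def IsSubmanifoldAt (N : Set M) (p : M) (d : ℕ) : Prop :=
  ∃ φ ∈ IsManifold.maximalAtlas (𝓡 n) ∞ M, p ∈ φ.source ∧
    ∃ V : Submodule ℝ (EuclideanSpace ℝ (Fin n)), Module.finrank ℝ V = d ∧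
      ∀ x ∈ φ.source, x ∈ N ↔ φ x ∈ V

variable (n) in
/-- `N` is an embedded smooth submanifold without boundary (the dimensions of different connected
components may differ). -/
def IsSmoothSubmanifold (N : Set M) : Prop :=
  ∀ p ∈ N, ∃ d, IsSubmanifoldAt (n := n) N p d

variable (n) in
/-- At each of its points, the submanifold `N` of the `n`-manifold `M` has codimension at
least `c`. -/
def CodimAtLeast (N : Set M) (c : ℕ) : Prop :=
  ∀ p ∈ N, ∃ d, IsSubmanifoldAt (n := n) N p d ∧ d + c ≤ n

variable (n) in
/-- The tangent bundle of `N` as a subset of `TM`: the velocities of smooth curves in `N`. -/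
def tangentVectors (N : Set M) : Set (TangentBundle (𝓡 n) M) :=
  {w | ∃ γ : ℝ → M, ContMDiff 𝓘(ℝ, ℝ) (𝓡 n) ∞ γ ∧ (∀ t, γ t ∈ N) ∧
    w = tangentMap 𝓘(ℝ, ℝ) (𝓡 n) γ ⟨0, (1 : ℝ)⟩}

variable (n) in
/-- The normal bundle `νN` as a subset of `TM`: the vectors at points of `N` that are orthogonal
to `N`. -/
def normalBundle [RiemannianBundle (fun x : M => TangentSpace (𝓡 n) x)] (N : Set M) :
    Set (TangentBundle (𝓡 n) M) :=
  {v | v.proj ∈ N ∧ ∀ w : TangentSpace (𝓡 n) v.proj,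
    (⟨v.proj, w⟩ : TangentBundle (𝓡 n) M) ∈ tangentVectors n N → inner ℝ v.snd w = 0}

variable (n) in
/-- The subset `U` of `M` is `G`-equivariantly diffeomorphic to the normal bundle of `N`, on which
`G` acts through the differentials of its elements. -/
def EquivDiffeoNormalBundle (G : Type*) [Group G] [MulAction G M] [IsManifold (𝓡 n) ∞ M]
    [RiemannianBundle (fun x : M => TangentSpace (𝓡 n) x)] (U N : Set M) : Prop :=
  ∃ (Φ : TangentBundle (𝓡 n) M → M) (Ψ : M → TangentBundle (𝓡 n) M),
    ContMDiffOn (𝓡 n).tangent (𝓡 n) ∞ Φ (normalBundle n N) ∧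
    ContMDiffOn (𝓡 n) (𝓡 n).tangent ∞ Ψ U ∧
    MapsTo Φ (normalBundle n N) U ∧ MapsTo Ψ U (normalBundle n N) ∧
    InvOn Ψ Φ (normalBundle n N) U ∧
    ∀ (g : G), ∀ v ∈ normalBundle n N,
      Φ (tangentMap (𝓡 n) (𝓡 n) (fun x : M => g • x) v) = g • Φ v

end Submanifold

/-! ### Two-valued cocycles on simply connected spaces -/

/-! Write `P` for the preimage of `B`, and let `Φ`, `Ψ` be the mutually inverse maps between the
normal bundle of `N` and the complement of `P`. Orbits of the connected group are connected and the
orbit map is open, so `P` is connected (`OrbitSpace.isPreconnected_preimage_proj`). It remains to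
exclude components of `N` of codimension 0 and 1.

Codimension 0 (`not_isSubmanifoldAt_of_diffeo`): the part of `N` of full dimension is open and
closed, hence all of `M`, and the normal bundle is the zero bundle. Then `Φ` embeds the compact
manifold `M` onto the complement of `P` as an open and closed set, so `P` is empty, a contradiction.

Codimension 1 (`not_isSubmanifoldAt_of_diffeo_of_simplyConnected`): let `S` be the hypersurface part
of `N` and `Z` the image under `Φ` of the zero section over `S`. Since `M` is simply connected, the
hypersurface `Z` is two-sided: some sign function `f` is locally constant off `Z` and changes across
it (`exists_side_function`, by trivializing a double cover). The connected set `P` misses `Z`, so it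
lies on one side. Points over `S` on the other side cannot accumulate at `P`; together with `Z` they
form a closed, hence compact, subset of `M`. Yet this subset contains the image of a whole normal
ray, on which the norm of `Ψ` is unbounded. -/

/-- On a simply connected space, a locally constant `±1`-valued cocycle which is the coboundary of
arbitrary functions `ε i` is the coboundary of locally constant ones. -/
theorem exists_continuousOn_mul_of_simplyConnected {X ι : Type*} [TopologicalSpace X]
    [SimplyConnectedSpace X] [LocallyPathConnectedSpace X] (U : ι → Set X)
    (hU : ∀ i, IsOpen (U i)) (hcover : ∀ x, ∃ i, x ∈ U i) (ε : ι → X → ℤˣ)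
    (hε : ∀ i j, ContinuousOn (fun x => ε i x * ε j x) (U i ∩ U j)) :
    ∃ h : X → ℤˣ, ∀ i, ContinuousOn (fun x => h x * ε i x) (U i) := by
  have hsq : ∀ u : ℤˣ, u * u = 1 := Int.units_mul_self
  choose idx hidx using hcover
  -- The double cover with transition functions `ε i * ε j`. The `ε i` themselves may be
  -- discontinuous; writing the cocycle as their coboundary makes the cocycle identity automatic.
  let Z : FiberBundleCore ι X ℤˣ :=
    { baseSet := U
      isOpen_baseSet := hU
      indexAt := idx
      mem_baseSet_at := hidx
      coordChange := fun i j x v => ε i x * ε j x * v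
      coordChange_self := fun i x _ v => by rw [hsq, one_mul]
      continuousOn_coordChange := fun i j =>
        ((hε i j).comp continuousOn_fst fun p hp => hp.1).mul continuousOn_snd
      coordChange_comp := fun i j k x _ v => by
        calc ε j x * ε k x * (ε i x * ε j x * v) = ε j x * ε j x * (ε i x * ε k x * v) := by ac_rfl
          _ = _ := by rw [hsq, one_mul] }
  have hcov : IsCoveringMap (π ℤˣ Z.Fiber) := FiberBundle.isCoveringMap
  obtain ⟨x₀⟩ : Nonempty X := inferInstance
  -- A lift of the identity is a global section of the cover; this is where simple connectedness
  -- enters.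
  obtain ⟨s, ⟨-, hs⟩, -⟩ := hcov.existsUnique_continuousMap_lifts (ContinuousMap.id X) x₀
    (⟨x₀, (1 : ℤˣ)⟩ : Z.TotalSpace) rfl
  have hs' : ∀ x, (s x).proj = x := fun x => congrFun hs x
  let val : Z.TotalSpace → ℤˣ := fun p => p.2
  -- Multiplying the fibre coordinate of the section by `ε (idx x) x` removes its dependence on the
  -- chosen index; the section reads `h * ε i` in the `i`-th trivialization.
  refine ⟨fun x => ε (idx x) x * val (s x), fun i => ?_⟩
  have hcont : ContinuousOn (fun x => (Z.localTriv i (s x)).2) (U i) := by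
    refine continuousOn_snd.comp ((Z.localTriv i).continuousOn_toFun.comp
      s.continuous.continuousOn fun x hx => ?_) (mapsTo_univ _ _)
    change (s x).proj ∈ U i
    rwa [hs' x]
  refine hcont.congr fun x hx => ?_
  change _ = ε (idx (s x).proj) (s x).proj * ε i (s x).proj * val (s x)
  rw [hs' x]
  exact mul_right_comm _ _ _

/-- The sign of a nonzero real number, as an integral unit. -/
noncomputable def signUnit (t : ℝ) : ℤˣ := if 0 < t then 1 else -1

theorem signUnit_of_pos {t : ℝ} (h : 0 < t) : signUnit t = 1 := if_pos h

theorem signUnit_of_neg {t : ℝ} (h : t < 0) : signUnit t = -1 := if_neg h.not_gt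

theorem signUnit_mul {s t : ℝ} (hs : s ≠ 0) (ht : t ≠ 0) :
    signUnit (s * t) = signUnit s * signUnit t := by
  rcases hs.lt_or_gt with hs | hs <;> rcases ht.lt_or_gt with ht | ht
  · rw [signUnit_of_neg hs, signUnit_of_neg ht, signUnit_of_pos (mul_pos_of_neg_of_neg hs ht)]; rfl
  · rw [signUnit_of_neg hs, signUnit_of_pos ht, signUnit_of_neg (mul_neg_of_neg_of_pos hs ht)]; rfl
  · rw [signUnit_of_pos hs, signUnit_of_neg ht, signUnit_of_neg (mul_neg_of_pos_of_neg hs ht)]; rfl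
  · rw [signUnit_of_pos hs, signUnit_of_pos ht, signUnit_of_pos (mul_pos hs ht)]; rfl

theorem ContinuousOn.signUnit {X : Type*} [TopologicalSpace X] {f : X → ℝ} {s : Set X}
    (hf : ContinuousOn f s) (h0 : ∀ x ∈ s, f x ≠ 0) :
    ContinuousOn (fun x => signUnit (f x)) s := by
  intro x hx
  have hev : (fun y => _root_.signUnit (f y)) =ᶠ[𝓝[s] x] fun _ => _root_.signUnit (f x) := by
    rcases (h0 x hx).lt_or_gt with h | h
    · filter_upwards [(hf x hx).eventually (gt_mem_nhds h)] with y hy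
      rw [signUnit_of_neg hy, signUnit_of_neg h]
    · filter_upwards [(hf x hx).eventually (lt_mem_nhds h)] with y hy
      rw [signUnit_of_pos hy, signUnit_of_pos h]
  exact continuousWithinAt_const.congr_of_eventuallyEq hev rfl

/-! ### The quotient map to the orbit space -/

section Orbit

variable {G M : Type*} [Group G] [MetricSpace M] [MulAction G M] [IsIsometricSMul G M]
  [TopologicalSpace G] [CompactSpace G] [ContinuousSMul G M]

/-- The distance of orbits is attained, so every orbit at distance less than `r` from that of `x`
meets the `r`-ball around `x`. -/
theorem OrbitSpace.isOpenMap_proj : IsOpenMap (OrbitSpace.proj G : M → OrbitSpace G M) := by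
  refine IsOpenMap.of_nhds_le fun x => ?_
  intro s hs
  obtain ⟨r, hr, hrs⟩ := Metric.mem_nhds_iff.1 (mem_map.1 hs)
  refine Metric.mem_nhds_iff.2 ⟨r, hr, fun b hb => ?_⟩
  obtain ⟨y, rfl⟩ := Quotient.exists_rep b
  obtain ⟨g, hg⟩ := OrbitSpace.exists_dist_proj_eq (G := G) x y
  have hb' : dist (OrbitSpace.proj G x) (OrbitSpace.proj G y) < r := by
    rw [dist_comm]; exact hb
  have hmem : OrbitSpace.proj G (g • y) ∈ s := hrs (by rw [Metric.mem_ball, dist_comm, ← hg]; exact hb')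
  have : OrbitSpace.proj G (g • y) = OrbitSpace.proj G y :=
    Quotient.sound (s := MulAction.orbitRel G M) (MulAction.orbitRel_apply.2 ⟨g, rfl⟩)
  rwa [this] at hmem

/-- The fibres are orbits, hence connected. If two open sets cover the preimage, their open images
meet in `B`, and the connected fibre over a common point then meets both sets at once. -/
theorem OrbitSpace.isPreconnected_preimage_proj [PreconnectedSpace G] {B : Set (OrbitSpace G M)}
    (hB : IsPreconnected B) : IsPreconnected (OrbitSpace.proj G ⁻¹' B : Set M) := by
  have hsurj : Function.Surjective (OrbitSpace.proj G : M → OrbitSpace G M) := Quotient.exists_rep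
  have hfib : ∀ x y : M, OrbitSpace.proj G x = OrbitSpace.proj G y → x ∈ MulAction.orbit G y :=
    fun x y h => MulAction.orbitRel_apply.1 (Quotient.exact (s := MulAction.orbitRel G M) h)
  have hfib' : ∀ x y : M, x ∈ MulAction.orbit G y → OrbitSpace.proj G x = OrbitSpace.proj G y :=
    fun x y h => Quotient.sound (s := MulAction.orbitRel G M) (MulAction.orbitRel_apply.2 h)
  have horb : ∀ x : M, IsPreconnected (MulAction.orbit G x) := fun x =>
    isPreconnected_range (continuous_id.smul continuous_const)
  intro u v hu hv huv hBu hBv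
  obtain ⟨_, hbB, ⟨x, hxu, rfl⟩, ⟨y, hyv, hyx⟩⟩ := hB (OrbitSpace.proj G '' u)
    (OrbitSpace.proj G '' v) (isOpenMap_proj u hu) (isOpenMap_proj v hv)
    (fun b hb => by
      obtain ⟨z, rfl⟩ := hsurj b
      exact (huv hb).imp (mem_image_of_mem _) (mem_image_of_mem _))
    (by obtain ⟨z, hz, hzu⟩ := hBu; exact ⟨_, hz, z, hzu, rfl⟩)
    (by obtain ⟨z, hz, hzv⟩ := hBv; exact ⟨_, hz, z, hzv, rfl⟩)
  have hsub : MulAction.orbit G x ⊆ OrbitSpace.proj G ⁻¹' B := fun z hz => by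
    rw [mem_preimage, hfib' z x hz]; exact hbB
  obtain ⟨z, hz, hzuv⟩ := horb x u v hu hv (hsub.trans huv)
    ⟨x, MulAction.mem_orbit_self x, hxu⟩ ⟨y, hfib y x hyx, hyv⟩
  exact ⟨z, hsub hz, hzuv⟩

end Orbit

/-! ### Inverse function theorem and charts of the tangent bundle -/

section LocalGeometry

variable {n : ℕ} {M : Type*} [MetricSpace M] [ChartedSpace (EuclideanSpace ℝ (Fin n)) M]

local notation "𝔼" => EuclideanSpace ℝ (Fin n)

/-- The chain rule for `R ∘ F = id` makes the differential of `F` injective, hence bijective as the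
dimensions agree, and the inverse function theorem applies. Differentiability of `R` within `U`
suffices, so `U` need not be known to be a neighborhood of `F z`. -/
theorem mem_nhds_image_of_leftInverse [IsManifold (𝓡 n) ∞ M] {O : Set 𝔼} (hO : IsOpen O)
    {F : 𝔼 → M} (hF : ContMDiffOn (𝓡 n) (𝓡 n) ∞ F O) {U : Set M} (hFU : MapsTo F O U)
    {R : M → 𝔼} {z : 𝔼} (hz : z ∈ O) (hR : MDifferentiableWithinAt (𝓡 n) (𝓡 n) R U (F z))
    (hRF : ∀ z ∈ O, R (F z) = z) : F '' O ∈ 𝓝 (F z) := by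
  have hOz : O ∈ 𝓝 z := hO.mem_nhds hz
  have hFz : ContMDiffAt (𝓡 n) (𝓡 n) ∞ F z := hF.contMDiffAt hOz
  have hF' := (hFz.mdifferentiableAt (by simp)).hasMFDerivAt
  set F' : 𝔼 →L[ℝ] TangentSpace (𝓡 n) (F z) := mfderiv (𝓡 n) (𝓡 n) F z with hF'def
  have hcomp := hR.hasMFDerivWithinAt.comp z hF'.hasMFDerivWithinAt (s := O) hFU
  have hid : HasMFDerivWithinAt (𝓡 n) (𝓡 n) (R ∘ F) O z
      (ContinuousLinearMap.id ℝ (TangentSpace (𝓡 n) z)) :=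
    (hasMFDerivWithinAt_id (I := 𝓡 n) (M := 𝔼) O z).congr_of_eventuallyEq
      (eventually_of_mem self_mem_nhdsWithin hRF) (hRF z hz)
  have huniq := (hO.uniqueMDiffWithinAt (I := 𝓡 n) hz).eq hcomp hid
  have hinj : Function.Injective F' := by
    intro a b hab
    have ha := DFunLike.congr_fun huniq a
    have hb := DFunLike.congr_fun huniq b
    exact ha.symm.trans ((congrArg (mfderivWithin (𝓡 n) (𝓡 n) R U (F z)) hab).trans hb)
  have hsurj : Function.Surjective F' :=
    (LinearMap.injective_iff_surjective (V := 𝔼) (f := F'.toLinearMap)).1 hinj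
  set c := chartAt 𝔼 (F z)
  have hcz : F z ∈ c.source := mem_chart_source 𝔼 (F z)
  have hc : c.MDifferentiable (𝓡 n) (𝓡 n) := mdifferentiable_chart (F z)
  have hcF : ContDiffAt ℝ ∞ (c ∘ F) z :=
    ((contMDiffAt_of_mem_maximalAtlas (IsManifold.chart_mem_maximalAtlas (F z)) hcz).comp z
      hFz).contDiffAt
  have hcF' : HasFDerivAt (c ∘ F) (mfderiv (𝓡 n) (𝓡 n) c (F z) ∘L F' : 𝔼 →L[ℝ] 𝔼) z :=
    (((hc.mdifferentiableAt hcz).hasMFDerivAt).comp z hF').hasFDerivAt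
  have hmap := (hcF.hasStrictFDerivAt' hcF' (by simp)).map_nhds_eq_of_surj
    (LinearMap.range_eq_top.2 ((hc.mfderiv_surjective hcz).comp hsurj))
  have hev : ∀ᶠ y in 𝓝 z, (c.symm ∘ (c ∘ F)) y = F y := by
    filter_upwards [hFz.continuousAt.preimage_mem_nhds (c.open_source.mem_nhds hcz)] with y hy
    exact c.left_inv hy
  have hmapF : map F (𝓝 z) = 𝓝 (F z) := by
    rw [← map_congr hev, ← map_map, hmap]
    exact c.symm_map_nhds_eq hcz
  rw [← hmapF]
  exact image_mem_map hOz

/-- The coordinates of a tangent vector in the chart `φ`. -/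
noncomputable def chartVel (φ : OpenPartialHomeomorph M 𝔼) (v : TangentBundle (𝓡 n) M) : 𝔼 :=
  mfderiv (𝓡 n) (𝓡 n) φ v.proj v.snd

/-- The tangent vector with coordinates `b` in the chart `φ`, at the point with coordinates `y`. -/
noncomputable def chartLift (φ : OpenPartialHomeomorph M 𝔼) (y b : 𝔼) : TangentBundle (𝓡 n) M :=
  ⟨φ.symm y, mfderiv (𝓡 n) (𝓡 n) φ.symm y b⟩

theorem chartVel_smul (φ : OpenPartialHomeomorph M 𝔼) (x : M) (t : ℝ)
    (w : TangentSpace (𝓡 n) x) : chartVel φ ⟨x, t • w⟩ = t • chartVel φ ⟨x, w⟩ :=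
  map_smul (mfderiv (𝓡 n) (𝓡 n) φ x) t w

theorem chartVel_sub (φ : OpenPartialHomeomorph M 𝔼) (x : M)
    (v w : TangentSpace (𝓡 n) x) : chartVel φ ⟨x, v - w⟩ = chartVel φ ⟨x, v⟩ - chartVel φ ⟨x, w⟩ :=
  map_sub (mfderiv (𝓡 n) (𝓡 n) φ x) v w

theorem chartVel_zero (φ : OpenPartialHomeomorph M 𝔼) (x : M) :
    chartVel φ (⟨x, 0⟩ : TangentBundle (𝓡 n) M) = 0 :=
  map_zero (mfderiv (𝓡 n) (𝓡 n) φ x)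

theorem chartLift_zero (φ : OpenPartialHomeomorph M 𝔼) (y : 𝔼) :
    chartLift φ y 0 = ⟨φ.symm y, 0⟩ :=
  congrArg (TotalSpace.mk (φ.symm y)) (map_zero (mfderiv (𝓡 n) (𝓡 n) φ.symm y))

theorem TangentBundle.ext_of_eq {p q : TangentBundle (𝓡 n) M} (h : p.proj = q.proj)
    (h' : (p.snd : 𝔼) = (q.snd : 𝔼)) : p = q := by
  obtain ⟨x, v⟩ := p
  obtain ⟨y, w⟩ := q
  obtain rfl : x = y := h
  obtain rfl : v = w := h'
  rfl

theorem mdifferentiable_of_mem_maximalAtlas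
    {φ : OpenPartialHomeomorph M 𝔼}
    (hφ : φ ∈ IsManifold.maximalAtlas (𝓡 n) ∞ M) : φ.MDifferentiable (𝓡 n) (𝓡 n) :=
  ⟨(contMDiffOn_of_mem_maximalAtlas hφ).mdifferentiableOn (by simp),
    (contMDiffOn_symm_of_mem_maximalAtlas hφ).mdifferentiableOn (by simp)⟩

theorem chartVel_chartLift {φ : OpenPartialHomeomorph M 𝔼}
    (hφ : φ ∈ IsManifold.maximalAtlas (𝓡 n) ∞ M)
    {y : 𝔼} (hy : y ∈ φ.target) (b : 𝔼) :
    chartVel φ (chartLift φ y b) = b :=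
  DFunLike.congr_fun ((mdifferentiable_of_mem_maximalAtlas hφ).comp_symm_deriv hy) b

theorem chartLift_chartVel {φ : OpenPartialHomeomorph M 𝔼}
    (hφ : φ ∈ IsManifold.maximalAtlas (𝓡 n) ∞ M)
    {v : TangentBundle (𝓡 n) M} (hv : v.proj ∈ φ.source) :
    chartLift φ (φ v.proj) (chartVel φ v) = v := by
  have hd := mdifferentiable_of_mem_maximalAtlas hφ
  exact TangentBundle.ext_of_eq (φ.left_inv hv) (DFunLike.congr_fun (hd.symm_comp_deriv hv) v.snd)

variable [IsManifold (𝓡 n) ∞ M]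

theorem contMDiffOn_chartVel {φ : OpenPartialHomeomorph M 𝔼}
    (hφ : φ ∈ IsManifold.maximalAtlas (𝓡 n) ∞ M) :
    ContMDiffOn (𝓡 n).tangent (𝓡 n) ∞ (chartVel φ) {v | v.proj ∈ φ.source} := by
  have h := (contMDiffOn_of_mem_maximalAtlas hφ).contMDiffOn_tangentMapWithin (m := ∞) (by simp)
    φ.open_source.uniqueMDiffOn
  refine ((contMDiff_snd_tangentBundle_modelSpace 𝔼 (𝓡 n)).comp_contMDiffOn h).congr ?_
  intro v hv
  simp only [Function.comp, tangentMapWithin, chartVel]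
  rw [mfderivWithin_of_isOpen φ.open_source hv]

theorem contMDiffOn_chartLift {φ : OpenPartialHomeomorph M 𝔼}
    (hφ : φ ∈ IsManifold.maximalAtlas (𝓡 n) ∞ M)
    {E' : Type*} [NormedAddCommGroup E'] [NormedSpace ℝ E'] {O : Set E'}
    {f g : E' → 𝔼} (hf : ContDiffOn ℝ ∞ f O) (hg : ContDiffOn ℝ ∞ g O)
    (hfO : MapsTo f O φ.target) :
    ContMDiffOn 𝓘(ℝ, E') (𝓡 n).tangent ∞ (fun z => chartLift φ (f z) (g z)) O := by
  have h := (contMDiffOn_symm_of_mem_maximalAtlas hφ).contMDiffOn_tangentMapWithin (m := ∞)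
    (by simp) φ.open_target.uniqueMDiffOn
  have hfg : ContMDiffOn 𝓘(ℝ, E') (𝓡 n).tangent ∞
      (fun z => (⟨f z, g z⟩ : TangentBundle (𝓡 n) 𝔼)) O := by
    intro z hz
    refine Bundle.contMDiffWithinAt_totalSpace.2 ⟨(hf z hz).contMDiffWithinAt, ?_⟩
    convert! (hg z hz).contMDiffWithinAt with y
    simp
  refine (h.comp hfg fun z hz => hfO hz).congr ?_
  intro z hz
  simp only [Function.comp, tangentMapWithin, chartLift]
  rw [mfderivWithin_of_isOpen φ.open_target (hfO hz)]

theorem continuous_zero_tangentVector :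
    Continuous fun x : M => (⟨x, 0⟩ : TangentBundle (𝓡 n) M) :=
  (Bundle.contMDiff_zeroSection (n := ∞) (IB := 𝓡 n) ℝ
    (TangentSpace (𝓡 n) : M → Type _)).continuous

end LocalGeometry

/-! ### Tangent and normal vectors of a submanifold in charts -/

section LocalGeometry

variable {n : ℕ} {M : Type*} [MetricSpace M] [ChartedSpace (EuclideanSpace ℝ (Fin n)) M]

local notation "𝔼" => EuclideanSpace ℝ (Fin n)

theorem hasDerivAt_mem_submodule {V : Submodule ℝ 𝔼} {c : ℝ → 𝔼} {t : ℝ} {c' : 𝔼}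
    (hc : HasDerivAt c c' t) (hV : ∀ᶠ s in 𝓝 t, c s ∈ V) : c' ∈ V := by
  rw [← Submodule.orthogonal_orthogonal V, Submodule.mem_orthogonal]
  intro a ha
  have h1 : HasDerivAt (fun s => inner ℝ a (c s)) (inner ℝ a c') t :=
    (innerSL ℝ a).hasFDerivAt.comp_hasDerivAt t hc
  have h2 : HasDerivAt (fun s => inner ℝ a (c s)) 0 t := by
    refine (hasDerivAt_const t (0 : ℝ)).congr_of_eventuallyEq ?_
    filter_upwards [hV] with s hs
    exact Submodule.inner_left_of_mem_orthogonal hs ha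
  exact h1.unique h2

/-- Turns the definition by curves into linear algebra: in an adapted chart the tangent spaces are
all the fixed subspace `V`. -/
theorem mem_tangentVectors_iff {φ : OpenPartialHomeomorph M 𝔼}
    (hφ : φ ∈ IsManifold.maximalAtlas (𝓡 n) ∞ M) {N : Set M} {V : Submodule ℝ 𝔼}
    (hV : ∀ x ∈ φ.source, x ∈ N ↔ φ x ∈ V) {v : TangentBundle (𝓡 n) M} (hv : v.proj ∈ φ.source) :
    v ∈ tangentVectors n N ↔ v.proj ∈ N ∧ chartVel φ v ∈ V := by
  have hd := mdifferentiable_of_mem_maximalAtlas hφ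
  constructor
  · rintro ⟨γ, hγ, hγN, rfl⟩
    refine ⟨hγN 0, ?_⟩
    have hγ0 : γ 0 ∈ φ.source := hv
    have h1 : HasDerivAt (φ ∘ γ)
        (chartVel φ (tangentMap 𝓘(ℝ, ℝ) (𝓡 n) γ ⟨0, (1 : ℝ)⟩)) 0 := by
      have h2 : HasFDerivAt (φ ∘ γ) (mfderiv (𝓡 n) (𝓡 n) φ (γ 0) ∘L
          mfderiv 𝓘(ℝ, ℝ) (𝓡 n) γ 0 : ℝ →L[ℝ] 𝔼) 0 :=
        ((hd.mdifferentiableAt hγ0).hasMFDerivAt.comp (0 : ℝ)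
          (hγ.mdifferentiableAt (by simp)).hasMFDerivAt).hasFDerivAt
      exact hasFDerivAt_iff_hasDerivAt.1 h2
    refine hasDerivAt_mem_submodule h1 ?_
    filter_upwards [hγ.continuous.continuousAt.preimage_mem_nhds
      (φ.open_source.mem_nhds hγ0)] with s hs
    exact (hV _ hs).1 (hγN s)
  · rintro ⟨hvN, hvV⟩
    set y := φ v.proj with hy
    set b := chartVel φ v with hb
    have hyt : y ∈ φ.target := φ.map_source hv
    obtain ⟨r, hr, hrt⟩ := Metric.isOpen_iff.1 φ.open_target y hyt
    have hbpos : 0 < ‖b‖ + 1 := by positivity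
    set δ := r / (‖b‖ + 1) with hδ
    have hδpos : 0 < δ := by positivity
    -- The curve must stay in `N` for all times, so the straight line is slowed down by a bounded
    -- parameter with derivative `1` at `0`; `δ` is small enough to keep it in the chart.
    let s : ℝ → ℝ := fun t => δ * Real.sin (δ⁻¹ * t)
    let c : ℝ → 𝔼 := fun t => y + s t • b
    have hs : ContDiff ℝ ∞ s :=
      contDiff_const.mul (Real.contDiff_sin.comp (contDiff_const.mul contDiff_id))
    have hs' : HasDerivAt s 1 0 := by
      have h1 : HasDerivAt (fun t : ℝ => δ⁻¹ * t) δ⁻¹ 0 := by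
        simpa using (hasDerivAt_id (0 : ℝ)).const_mul δ⁻¹
      have h2 := h1.sin.const_mul δ
      simpa [hδpos.ne'] using h2
    have hs0 : s 0 = 0 := by simp [s]
    have hc : ContDiff ℝ ∞ c := contDiff_const.add (hs.smul contDiff_const)
    have hc' : HasDerivAt c b 0 := by
      have h1 := (hs'.smul_const b).const_add y
      rwa [one_smul] at h1
    have hc0 : c 0 = y := by simp [c, hs0]
    have hct : ∀ t, c t ∈ φ.target := fun t => hrt <| by
      rw [Metric.mem_ball, dist_eq_norm, add_sub_cancel_left, norm_smul, Real.norm_eq_abs, abs_mul,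
        abs_of_pos hδpos]
      calc δ * |Real.sin (δ⁻¹ * t)| * ‖b‖ ≤ δ * 1 * ‖b‖ := by
            gcongr; exact Real.abs_sin_le_one _
        _ < δ * (‖b‖ + 1) := by nlinarith
        _ = r := by rw [hδ]; field_simp
    have hcV : ∀ t, c t ∈ V := fun t => V.add_mem ((hV _ hv).1 hvN) (V.smul_mem _ hvV)
    refine ⟨φ.symm ∘ c, ?_, fun t => ?_, ?_⟩
    · exact (contMDiffOn_symm_of_mem_maximalAtlas hφ).comp_contMDiff hc.contMDiff hct
    · change φ.symm (c t) ∈ N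
      rw [hV _ (φ.map_target (hct t)), φ.right_inv (hct t)]
      exact hcV t
    · have hcd : MDifferentiableAt 𝓘(ℝ, ℝ) (𝓡 n) c (0 : ℝ) :=
        hc.contMDiff.mdifferentiableAt (by simp)
      have h1 : tangentMap 𝓘(ℝ, ℝ) (𝓡 n) c ⟨0, (1 : ℝ)⟩ = (⟨y, b⟩ : TangentBundle (𝓡 n) 𝔼) := by
        refine TangentBundle.ext_of_eq hc0 ?_
        have h2 : mfderiv 𝓘(ℝ, ℝ) 𝓘(ℝ, 𝔼) c 0 = fderiv ℝ c 0 := mfderiv_eq_fderiv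
        exact (DFunLike.congr_fun h2 (1 : ℝ)).trans
          (fderiv_apply_one_eq_deriv.trans hc'.deriv)
      have h2 : tangentMap 𝓘(ℝ, ℝ) (𝓡 n) (φ.symm ∘ c) ⟨0, (1 : ℝ)⟩ =
          tangentMap (𝓡 n) (𝓡 n) φ.symm (tangentMap 𝓘(ℝ, ℝ) (𝓡 n) c ⟨0, (1 : ℝ)⟩) :=
        tangentMap_comp_at (⟨0, (1 : ℝ)⟩ : TangentBundle 𝓘(ℝ, ℝ) ℝ)
          (hd.mdifferentiableAt_symm (hct 0)) hcd
      rw [h2, h1]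
      exact (chartLift_chartVel hφ hv).symm

variable [RiemannianBundle (fun x : M => TangentSpace (𝓡 n) x)]

/-- The Riemannian metric in the chart `φ`. -/
noncomputable def chartMetric (φ : OpenPartialHomeomorph M 𝔼) (y a b : 𝔼) : ℝ :=
  inner ℝ (mfderiv (𝓡 n) (𝓡 n) φ.symm y a) (mfderiv (𝓡 n) (𝓡 n) φ.symm y b)

theorem chartMetric_add_right (φ : OpenPartialHomeomorph M 𝔼) (y a b c : 𝔼) :
    chartMetric φ y a (b + c) = chartMetric φ y a b + chartMetric φ y a c :=
  (congrArg (inner ℝ _) (map_add (mfderiv (𝓡 n) (𝓡 n) φ.symm y) b c)).trans (inner_add_right _ _ _)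

theorem chartMetric_smul_right (φ : OpenPartialHomeomorph M 𝔼) (t : ℝ) (y a b : 𝔼) :
    chartMetric φ y a (t • b) = t * chartMetric φ y a b :=
  (congrArg (inner ℝ _) (map_smul (mfderiv (𝓡 n) (𝓡 n) φ.symm y) t b)).trans
    (real_inner_smul_right _ _ _)

theorem chartMetric_comm (φ : OpenPartialHomeomorph M 𝔼) (y a b : 𝔼) :
    chartMetric φ y a b = chartMetric φ y b a :=
  real_inner_comm _ _

theorem chartMetric_add_left (φ : OpenPartialHomeomorph M 𝔼) (y a b c : 𝔼) :
    chartMetric φ y (a + b) c = chartMetric φ y a c + chartMetric φ y b c := by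
  simp only [chartMetric_comm φ y _ c, chartMetric_add_right]

theorem chartMetric_smul_left (φ : OpenPartialHomeomorph M 𝔼) (t : ℝ) (y a b : 𝔼) :
    chartMetric φ y (t • a) b = t * chartMetric φ y a b := by
  simp only [chartMetric_comm φ y _ b, chartMetric_smul_right]

theorem chartLift_mem_normalBundle_iff {φ : OpenPartialHomeomorph M 𝔼}
    (hφ : φ ∈ IsManifold.maximalAtlas (𝓡 n) ∞ M) {N : Set M} {V : Submodule ℝ 𝔼}
    (hV : ∀ x ∈ φ.source, x ∈ N ↔ φ x ∈ V) {y : 𝔼} (hy : y ∈ φ.target) (a : 𝔼) :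
    chartLift φ y a ∈ normalBundle n N ↔ y ∈ V ∧ ∀ b ∈ V, chartMetric φ y a b = 0 := by
  have hys : φ.symm y ∈ φ.source := φ.map_target hy
  have hyN : φ.symm y ∈ N ↔ y ∈ V := by rw [hV _ hys, φ.right_inv hy]
  constructor
  · rintro ⟨h1, h2⟩
    refine ⟨hyN.1 h1, fun b hb => h2 (mfderiv (𝓡 n) (𝓡 n) φ.symm y b) ?_⟩
    refine (mem_tangentVectors_iff hφ hV (v := chartLift φ y b) hys).2 ⟨h1, ?_⟩
    rwa [chartVel_chartLift hφ hy]
  · rintro ⟨h1, h2⟩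
    refine ⟨hyN.2 h1, fun w hw => ?_⟩
    have hb := ((mem_tangentVectors_iff hφ hV (v := ⟨φ.symm y, w⟩) hys).1 hw).2
    have h3 := chartLift_chartVel hφ (v := ⟨φ.symm y, w⟩) hys
    rw [show φ (TotalSpace.proj (⟨φ.symm y, w⟩ : TangentBundle (𝓡 n) M)) = y from
      φ.right_inv hy] at h3
    have h4 : mfderiv (𝓡 n) (𝓡 n) φ.symm y (chartVel φ ⟨φ.symm y, w⟩) = w := by
      injection h3 with _ h4
    have h5 := h2 _ hb
    rw [chartMetric, h4] at h5
    exact h5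

theorem chartMetric_self_pos {φ : OpenPartialHomeomorph M 𝔼}
    (hφ : φ ∈ IsManifold.maximalAtlas (𝓡 n) ∞ M) {y : 𝔼} (hy : y ∈ φ.target) {a : 𝔼} (ha : a ≠ 0) :
    0 < chartMetric φ y a a := by
  refine real_inner_self_pos.2 fun h0 => ha ?_
  have h1 := chartVel_chartLift hφ hy a
  rw [chartLift, h0] at h1
  rw [← h1]
  exact chartVel_zero φ _

variable [IsManifold (𝓡 n) ∞ M]
  [IsContMDiffRiemannianBundle (𝓡 n) ∞ (EuclideanSpace ℝ (Fin n))
    (fun x : M => TangentSpace (𝓡 n) x)]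

theorem contDiffOn_chartMetric {φ : OpenPartialHomeomorph M 𝔼}
    (hφ : φ ∈ IsManifold.maximalAtlas (𝓡 n) ∞ M) (a b : 𝔼) :
    ContDiffOn ℝ ∞ (fun y => chartMetric φ y a b) φ.target := by
  have h : ∀ a : 𝔼, ContMDiffOn (𝓡 n) (𝓡 n).tangent ∞ (fun z => chartLift φ z a) φ.target :=
    fun a => contMDiffOn_chartLift hφ contDiffOn_id contDiffOn_const (mapsTo_id _)
  exact ((h a).inner_bundle (h b)).contDiffOn

/-- A smooth vector field along a chart domain which is normal to all level sets of the linear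
function `⟨e, ·⟩` of the coordinates. -/
theorem exists_contDiffOn_normal {φ : OpenPartialHomeomorph M 𝔼}
    (hφ : φ ∈ IsManifold.maximalAtlas (𝓡 n) ∞ M) {e : 𝔼} (he : e ≠ 0) :
    ∃ H : 𝔼 → 𝔼, ContDiffOn ℝ ∞ H φ.target ∧ ∀ y ∈ φ.target, inner ℝ e (H y) = 1 ∧
      ∀ b, inner ℝ e b = 0 → chartMetric φ y (H y) b = 0 := by
  let D : 𝔼 → 𝔼 → (𝔼 →L[ℝ] ℝ) := fun y a => LinearMap.toContinuousLinearMap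
    { toFun := fun b => chartMetric φ y a b
      map_add' := fun b c => chartMetric_add_right φ y a b c
      map_smul' := fun t b => chartMetric_smul_right φ t y a b }
  -- The metric as a map from vectors to covectors, invertible by positive definiteness.
  let G : 𝔼 → (𝔼 →L[ℝ] 𝔼 →L[ℝ] ℝ) := fun y => LinearMap.toContinuousLinearMap
    { toFun := D y
      map_add' := fun a c => ContinuousLinearMap.ext fun b => chartMetric_add_left φ y a c b
      map_smul' := fun t a => ContinuousLinearMap.ext fun b => chartMetric_smul_left φ t y a b }
  have hG : ∀ y a b, G y a b = chartMetric φ y a b := fun y a b => rfl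
  have hGs : ContDiffOn ℝ ∞ G φ.target :=
    contDiffOn_clm_apply.2 fun a => contDiffOn_clm_apply.2 fun b => contDiffOn_chartMetric hφ a b
  have hGe : ∀ y ∈ φ.target, ∃ L : 𝔼 ≃L[ℝ] (𝔼 →L[ℝ] ℝ), (L : 𝔼 →L[ℝ] 𝔼 →L[ℝ] ℝ) = G y := by
    intro y hy
    have hinj : Function.Injective (G y) := by
      refine (injective_iff_map_eq_zero (G y)).2 fun a ha => ?_
      by_contra ha0
      have := chartMetric_self_pos hφ hy ha0
      rw [← hG, ha] at this
      simp at this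
    have hfin : Module.finrank ℝ 𝔼 = Module.finrank ℝ (𝔼 →L[ℝ] ℝ) :=
      (InnerProductSpace.toDual ℝ 𝔼).toLinearEquiv.finrank_eq
    exact ⟨(LinearEquiv.ofInjectiveOfFinrankEq (G y).toLinearMap hinj hfin).toContinuousLinearEquiv,
      by ext; rfl⟩
  -- The Riemannian gradient of the coordinate function `⟨e, ·⟩`, smooth because inversion of
  -- operators is. Rescaling will normalize its pairing with `e` to `1`.
  let h₀ : 𝔼 → 𝔼 := fun y => (G y).inverse (innerSL ℝ e)
  have hh₀ : ContDiffOn ℝ ∞ h₀ φ.target := by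
    intro y hy
    obtain ⟨L, hL⟩ := hGe y hy
    have h1 : ContDiffAt ℝ ∞ ContinuousLinearMap.inverse (G y) := hL ▸ contDiffAt_map_inverse L
    exact (h1.comp_contDiffWithinAt y (hGs y hy)).clm_apply contDiffWithinAt_const
  have hGh : ∀ y ∈ φ.target, ∀ b, chartMetric φ y (h₀ y) b = inner ℝ e b := by
    intro y hy b
    obtain ⟨L, hL⟩ := hGe y hy
    rw [← hG]
    simp only [h₀]
    rw [← hL, ContinuousLinearMap.inverse_equiv]
    simp
  have hpos : ∀ y ∈ φ.target, 0 < inner ℝ e (h₀ y) := by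
    intro y hy
    rw [← hGh y hy]
    refine chartMetric_self_pos hφ hy fun h0 => he ?_
    have h1 := hGh y hy e
    rw [h0, ← zero_smul ℝ (0 : 𝔼), chartMetric_smul_left, zero_mul] at h1
    exact inner_self_eq_zero.1 h1.symm
  refine ⟨fun y => (inner ℝ e (h₀ y))⁻¹ • h₀ y, ?_, fun y hy => ⟨?_, fun b hb => ?_⟩⟩
  · exact ((contDiffOn_const.inner ℝ hh₀).inv fun y hy => (hpos y hy).ne').smul hh₀
  · rw [inner_smul_right, inv_mul_cancel₀ (hpos y hy).ne']
  · rw [chartMetric_smul_left, hGh y hy b, hb, mul_zero]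

end LocalGeometry

/-! ### Dimension of submanifolds and normal lines of hypersurfaces -/

section Submanifolds

variable {n : ℕ} {M : Type*} [MetricSpace M] [ChartedSpace (EuclideanSpace ℝ (Fin n)) M]

local notation "𝔼" => EuclideanSpace ℝ (Fin n)

theorem IsSubmanifoldAt.eventually {N : Set M} {x : M} {d : ℕ} (h : IsSubmanifoldAt (n := n) N x d) :
    ∀ᶠ y in 𝓝 x, IsSubmanifoldAt (n := n) N y d := by
  obtain ⟨φ, hφ, hx, V, hVd, hV⟩ := h
  filter_upwards [φ.open_source.mem_nhds hx] with y hy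
  exact ⟨φ, hφ, hy, V, hVd, hV⟩

/-- `tangentVectors` does not mention a chart, so this makes the dimension of `N` at a point
independent of the adapted chart. -/
theorem IsSubmanifoldAt.exists_submodule {N : Set M} {x : M} {d : ℕ}
    (h : IsSubmanifoldAt (n := n) N x d) (hx : x ∈ N) :
    ∃ T : Submodule ℝ (TangentSpace (𝓡 n) x), Module.finrank ℝ T = d ∧
      ∀ w, w ∈ T ↔ (⟨x, w⟩ : TangentBundle (𝓡 n) M) ∈ tangentVectors n N := by
  obtain ⟨φ, hφ, hxφ, V, hVd, hV⟩ := h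
  let D := ((mdifferentiable_of_mem_maximalAtlas hφ).mfderiv hxφ).toLinearEquiv
  refine ⟨V.map D.symm.toLinearMap, ?_, fun w => ?_⟩
  · rw [← hVd]
    exact LinearEquiv.finrank_map_eq D.symm V
  · rw [mem_tangentVectors_iff hφ hV (v := ⟨x, w⟩) hxφ]
    have h1 : w ∈ V.map D.symm.toLinearMap ↔ D w ∈ V := by
      constructor
      · rintro ⟨b, hb, rfl⟩
        have h2 : D (D.symm b) = b := D.apply_symm_apply b
        exact h2.symm ▸ hb
      · exact fun hw => ⟨D w, hw, D.symm_apply_apply w⟩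
    exact h1.trans ⟨fun hw => ⟨hx, hw⟩, fun hw => hw.2⟩

theorem IsSubmanifoldAt.unique {N : Set M} {x : M} {d d' : ℕ}
    (h : IsSubmanifoldAt (n := n) N x d) (h' : IsSubmanifoldAt (n := n) N x d') (hx : x ∈ N) :
    d = d' := by
  obtain ⟨T, hT, hT'⟩ := h.exists_submodule hx
  obtain ⟨W, hW, hW'⟩ := h'.exists_submodule hx
  have : T = W := Submodule.ext fun w => (hT' w).trans (hW' w).symm
  rw [← hT, ← hW, this]

theorem IsSubmanifoldAt.le {N : Set M} {x : M} {d : ℕ} (h : IsSubmanifoldAt (n := n) N x d) :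
    d ≤ n := by
  obtain ⟨φ, hφ, hxφ, V, hVd, hV⟩ := h
  simpa [hVd] using V.finrank_le

/-- The points at which a closed submanifold has a given dimension form a closed set. -/
theorem IsSmoothSubmanifold.isClosed_setOf {N : Set M} (hN : IsSmoothSubmanifold n N)
    (hNc : IsClosed N) (d : ℕ) : IsClosed {x | x ∈ N ∧ IsSubmanifoldAt (n := n) N x d} := by
  rw [← isOpen_compl_iff, isOpen_iff_mem_nhds]
  intro x hx
  by_cases hxN : x ∈ N
  · obtain ⟨d', hd'⟩ := hN x hxN
    filter_upwards [hd'.eventually] with y hy hyS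
    exact hx ⟨hxN, (hyS.2.unique hy hyS.1) ▸ hd'⟩
  · filter_upwards [hNc.isOpen_compl.mem_nhds hxN] with y hy hyS
    exact hy hyS.1

/-- The chart `φ` takes `N` to the hyperplane orthogonal to the unit vector `e`. -/
def IsHypersurfaceChart (N : Set M) (φ : OpenPartialHomeomorph M 𝔼) (e : 𝔼) : Prop :=
  φ ∈ IsManifold.maximalAtlas (𝓡 n) ∞ M ∧ ‖e‖ = 1 ∧ ∀ x ∈ φ.source, x ∈ N ↔ inner ℝ e (φ x) = 0

theorem IsSubmanifoldAt.exists_isHypersurfaceChart {N : Set M} {x : M} {d : ℕ}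
    (h : IsSubmanifoldAt (n := n) N x d) (hd : d + 1 = n) :
    ∃ (φ : OpenPartialHomeomorph M 𝔼) (e : 𝔼), IsHypersurfaceChart N φ e ∧ x ∈ φ.source ∧
      ∀ y ∈ φ.source, IsSubmanifoldAt (n := n) N y d := by
  obtain ⟨φ, hφ, hx, V, hVd, hV⟩ := h
  have h1 : Module.finrank ℝ Vᗮ = 1 := by
    have := V.finrank_add_finrank_orthogonal
    rw [hVd, finrank_euclideanSpace_fin] at this
    omega
  obtain ⟨⟨a, haV⟩, ha0, ha⟩ := finrank_eq_one_iff'.1 h1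
  have ha0' : ‖a‖ ≠ 0 := fun h0 => ha0 (Subtype.ext (norm_eq_zero.1 h0))
  have hVa : ∀ b, b ∈ V ↔ inner ℝ a b = 0 := by
    intro b
    refine ⟨fun hb => Submodule.inner_left_of_mem_orthogonal hb haV, fun hb => ?_⟩
    rw [← Submodule.orthogonal_orthogonal V, Submodule.mem_orthogonal]
    intro u hu
    obtain ⟨t, ht⟩ := ha ⟨u, hu⟩
    have ht' : t • a = u := congrArg Subtype.val ht
    rw [← ht', real_inner_smul_left, hb, mul_zero]
  refine ⟨φ, ‖a‖⁻¹ • a, ⟨hφ, ?_, fun y hy => ?_⟩, hx, fun y hy => ⟨φ, hφ, hy, V, hVd, hV⟩⟩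
  · rw [norm_smul, norm_inv, norm_norm, inv_mul_cancel₀ ha0']
  · rw [hV y hy, hVa, real_inner_smul_left, mul_eq_zero, or_iff_right (inv_ne_zero ha0')]

theorem IsHypersurfaceChart.mem_iff {N : Set M} {φ : OpenPartialHomeomorph M 𝔼} {e : 𝔼}
    (h : IsHypersurfaceChart N φ e) :
    ∀ x ∈ φ.source, x ∈ N ↔ φ x ∈ (Submodule.span ℝ {e})ᗮ := by
  intro x hx
  rw [h.2.2 x hx, Submodule.mem_orthogonal_singleton_iff_inner_right]

/-- The differential of the coordinate function `⟨e, φ⟩`. -/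
noncomputable def conormal (φ : OpenPartialHomeomorph M 𝔼) (e : 𝔼) (v : TangentBundle (𝓡 n) M) :
    ℝ :=
  inner ℝ e (chartVel φ v)

theorem conormal_smul (φ : OpenPartialHomeomorph M 𝔼) (e : 𝔼) (x : M) (t : ℝ)
    (w : TangentSpace (𝓡 n) x) : conormal φ e ⟨x, t • w⟩ = t * conormal φ e ⟨x, w⟩ := by
  rw [conormal, chartVel_smul, real_inner_smul_right, conormal]

theorem conormal_sub (φ : OpenPartialHomeomorph M 𝔼) (e : 𝔼) (x : M)
    (v w : TangentSpace (𝓡 n) x) :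
    conormal φ e ⟨x, v - w⟩ = conormal φ e ⟨x, v⟩ - conormal φ e ⟨x, w⟩ := by
  rw [conormal, chartVel_sub, inner_sub_right, conormal, conormal]

theorem conormal_zero (φ : OpenPartialHomeomorph M 𝔼) (e : 𝔼) (x : M) :
    conormal φ e (⟨x, 0⟩ : TangentBundle (𝓡 n) M) = 0 := by
  rw [conormal, chartVel_zero, inner_zero_right]

theorem IsHypersurfaceChart.continuousOn_conormal [IsManifold (𝓡 n) ∞ M] {N : Set M}
    {φ : OpenPartialHomeomorph M 𝔼} {e : 𝔼} (h : IsHypersurfaceChart N φ e) :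
    ContinuousOn (conormal φ e) {v | v.proj ∈ φ.source} :=
  continuousOn_const.inner (contMDiffOn_chartVel h.1).continuousOn

variable [RiemannianBundle (fun x : M => TangentSpace (𝓡 n) x)]

theorem zero_mem_normalBundle {N : Set M} {x : M} (hx : x ∈ N) :
    (⟨x, 0⟩ : TangentBundle (𝓡 n) M) ∈ normalBundle n N :=
  ⟨hx, fun w _ => inner_zero_left w⟩

theorem smul_mem_normalBundle {N : Set M} {x : M} {v : TangentSpace (𝓡 n) x} (t : ℝ)
    (hv : (⟨x, v⟩ : TangentBundle (𝓡 n) M) ∈ normalBundle n N) :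
    (⟨x, t • v⟩ : TangentBundle (𝓡 n) M) ∈ normalBundle n N := by
  refine ⟨hv.1, fun w hw => ?_⟩
  have h1 : inner ℝ v w = 0 := hv.2 w hw
  change inner ℝ (t • v) w = 0
  rw [real_inner_smul_left, h1, mul_zero]

theorem sub_mem_normalBundle {N : Set M} {x : M} {v v' : TangentSpace (𝓡 n) x}
    (hv : (⟨x, v⟩ : TangentBundle (𝓡 n) M) ∈ normalBundle n N)
    (hv' : (⟨x, v'⟩ : TangentBundle (𝓡 n) M) ∈ normalBundle n N) :
    (⟨x, v - v'⟩ : TangentBundle (𝓡 n) M) ∈ normalBundle n N := by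
  refine ⟨hv.1, fun w hw => ?_⟩
  have h1 : inner ℝ v w = 0 := hv.2 w hw
  have h2 : inner ℝ v' w = 0 := hv'.2 w hw
  change inner ℝ (v - v') w = 0
  rw [inner_sub_left, h1, h2, sub_zero]

theorem eq_zero_of_mem_normalBundle_of_mem_tangentVectors {N : Set M} {x : M}
    {v : TangentSpace (𝓡 n) x} (hv : (⟨x, v⟩ : TangentBundle (𝓡 n) M) ∈ normalBundle n N)
    (hv' : (⟨x, v⟩ : TangentBundle (𝓡 n) M) ∈ tangentVectors n N) : v = 0 :=
  inner_self_eq_zero.1 (hv.2 v hv')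

namespace IsHypersurfaceChart

variable {N : Set M} {φ : OpenPartialHomeomorph M (EuclideanSpace ℝ (Fin n))}
  {e : EuclideanSpace ℝ (Fin n)}

/-- The kernel of the conormal is the tangent space, which meets the normal space only in zero. -/
theorem eq_zero_of_conormal_eq_zero (h : IsHypersurfaceChart N φ e) {x : M} (hx : x ∈ φ.source)
    {v : TangentSpace (𝓡 n) x} (hv : (⟨x, v⟩ : TangentBundle (𝓡 n) M) ∈ normalBundle n N)
    (h0 : conormal φ e ⟨x, v⟩ = 0) : v = 0 :=
  eq_zero_of_mem_normalBundle_of_mem_tangentVectors hv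
    ((mem_tangentVectors_iff h.1 h.mem_iff (v := ⟨x, v⟩) hx).2
      ⟨hv.1, Submodule.mem_orthogonal_singleton_iff_inner_right.2 h0⟩)

/-- Normal spaces of a hypersurface are lines, in a form that lets signs of normal vectors be
compared: the difference of the two sides is normal and has conormal zero. -/
theorem conormal_smul_comm (h : IsHypersurfaceChart N φ e) {x : M} (hx : x ∈ φ.source)
    {v w : TangentSpace (𝓡 n) x} (hv : (⟨x, v⟩ : TangentBundle (𝓡 n) M) ∈ normalBundle n N)
    (hw : (⟨x, w⟩ : TangentBundle (𝓡 n) M) ∈ normalBundle n N) :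
    conormal φ e ⟨x, v⟩ • w = conormal φ e ⟨x, w⟩ • v := by
  refine sub_eq_zero.1 (h.eq_zero_of_conormal_eq_zero hx
    (sub_mem_normalBundle (smul_mem_normalBundle _ hw) (smul_mem_normalBundle _ hv)) ?_)
  rw [conormal_sub, conormal_smul, conormal_smul, mul_comm, sub_self]

variable [IsManifold (𝓡 n) ∞ M]
  [IsContMDiffRiemannianBundle (𝓡 n) ∞ (EuclideanSpace ℝ (Fin n))
    (fun x : M => TangentSpace (𝓡 n) x)]

theorem exists_normal (h : IsHypersurfaceChart N φ e) :
    ∃ H : 𝔼 → 𝔼, ContDiffOn ℝ ∞ H φ.target ∧ ∀ y ∈ φ.target, ∀ t : ℝ,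
      conormal φ e (chartLift φ y (t • H y)) = t ∧
      (inner ℝ e y = 0 → chartLift φ y (t • H y) ∈ normalBundle n N) := by
  have he : e ≠ 0 := fun h0 => by simpa [h0] using h.2.1
  obtain ⟨H, hH, hH'⟩ := exists_contDiffOn_normal h.1 he
  refine ⟨H, hH, fun y hy t => ⟨?_, fun hey => ?_⟩⟩
  · rw [conormal, chartVel_chartLift h.1 hy, real_inner_smul_right, (hH' y hy).1, mul_one]
  · refine (chartLift_mem_normalBundle_iff h.1 h.mem_iff hy _).2
      ⟨Submodule.mem_orthogonal_singleton_iff_inner_right.2 hey, fun b hb => ?_⟩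
    rw [chartMetric_smul_left, (hH' y hy).2 b
      (Submodule.mem_orthogonal_singleton_iff_inner_right.1 hb), mul_zero]

/-- A continuous frame of the normal bundle over the domain of a chart. -/
theorem exists_frame (h : IsHypersurfaceChart N φ e) :
    ∃ k : ∀ x : M, TangentSpace (𝓡 n) x,
      ContinuousOn (fun x => (⟨x, k x⟩ : TangentBundle (𝓡 n) M)) φ.source ∧
      ∀ x ∈ φ.source, conormal φ e ⟨x, k x⟩ = 1 ∧
        (x ∈ N → (⟨x, k x⟩ : TangentBundle (𝓡 n) M) ∈ normalBundle n N) := by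
  obtain ⟨H, hH, hH'⟩ := h.exists_normal
  have heq : ∀ x ∈ φ.source, (⟨x, mfderiv (𝓡 n) (𝓡 n) φ.symm (φ x) (H (φ x))⟩ :
      TangentBundle (𝓡 n) M) = chartLift φ (φ x) (H (φ x)) :=
    fun x hx => TangentBundle.ext_of_eq (φ.left_inv hx).symm rfl
  refine ⟨fun x => mfderiv (𝓡 n) (𝓡 n) φ.symm (φ x) (H (φ x)), ?_, fun x hx => ?_⟩
  · refine ContinuousOn.congr ?_ heq
    exact (contMDiffOn_chartLift h.1 contDiffOn_id hH (mapsTo_id _)).continuousOn.comp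
      φ.continuousOn φ.mapsTo
  · have h1 := hH' (φ x) (φ.map_source hx) 1
    rw [one_smul] at h1
    rw [heq x hx]
    exact ⟨h1.1, fun hxN => h1.2 ((h.2.2 x hx).1 hxN)⟩

/-- The image of the normal bundle of a hypersurface under a diffeomorphism is a neighborhood of
the image of the zero section. -/
theorem image_mem_nhds (h : IsHypersurfaceChart N φ e) {U : Set M}
    {Φ : TangentBundle (𝓡 n) M → M} {Ψ : M → TangentBundle (𝓡 n) M}
    (hΦ : ContMDiffOn (𝓡 n).tangent (𝓡 n) ∞ Φ (normalBundle n N))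
    (hΨ : ContMDiffOn (𝓡 n) (𝓡 n).tangent ∞ Ψ U) (hΦU : MapsTo Φ (normalBundle n N) U)
    (hΨΦ : LeftInvOn Ψ Φ (normalBundle n N)) {x : M} (hx : x ∈ φ.source) (hxN : x ∈ N) :
    Φ '' (normalBundle n N ∩ {v | v.proj ∈ φ.source}) ∈ 𝓝 (Φ ⟨x, 0⟩) := by
  obtain ⟨H, hH, hH'⟩ := h.exists_normal
  let t : 𝔼 → ℝ := fun z => inner ℝ e z
  -- `q` projects orthogonally to the hyperplane and `t` is the height over it. Thus `σ`
  -- parametrizes the normal bundle over the chart by an open subset of Euclidean space, with smooth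
  -- left inverse `r`; so `r ∘ Ψ` is a left inverse of `Φ ∘ σ`.
  let q : 𝔼 → 𝔼 := fun z => z - t z • e
  let σ : 𝔼 → TangentBundle (𝓡 n) M := fun z => chartLift φ (q z) (t z • H (q z))
  let r : TangentBundle (𝓡 n) M → 𝔼 := fun v => φ v.proj + conormal φ e v • e
  have ht : ContDiff ℝ ∞ t := contDiff_const.inner ℝ contDiff_id
  have hq : ContDiff ℝ ∞ q := contDiff_id.sub (ht.smul contDiff_const)
  set O : Set 𝔼 := q ⁻¹' φ.target with hOdef
  have hO : IsOpen O := φ.open_target.preimage hq.continuous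
  have hqe : ∀ z, inner ℝ e (q z) = 0 := fun z => by
    simp only [q, t]
    rw [inner_sub_right, real_inner_smul_right, real_inner_self_eq_norm_sq, h.2.1]
    ring
  have hσ : ContMDiffOn (𝓡 n) (𝓡 n).tangent ∞ σ O :=
    contMDiffOn_chartLift h.1 hq.contDiffOn
      (ht.contDiffOn.smul (hH.comp hq.contDiffOn fun z hz => hz)) fun z hz => hz
  have hσν : MapsTo σ O (normalBundle n N) := fun z hz => (hH' (q z) hz (t z)).2 (hqe z)
  have hσp : ∀ z ∈ O, (σ z).proj ∈ φ.source := fun z hz => φ.map_target hz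
  have hrσ : ∀ z ∈ O, r (σ z) = z := by
    intro z hz
    have h1 : φ (σ z).proj = q z := φ.right_inv hz
    have h2 : conormal φ e (σ z) = t z := (hH' (q z) hz (t z)).1
    simp only [r, h1, h2, q, sub_add_cancel]
  have hr : ContMDiffOn (𝓡 n).tangent (𝓡 n) ∞ r {v | v.proj ∈ φ.source} := by
    have h1 : ContMDiffOn (𝓡 n).tangent (𝓡 n) ∞ (fun v : TangentBundle (𝓡 n) M => φ v.proj)
        {v | v.proj ∈ φ.source} :=
      (contMDiffOn_of_mem_maximalAtlas h.1).comp
        (Bundle.contMDiff_proj (TangentSpace (𝓡 n))).contMDiffOn fun v hv => hv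
    have h2 : ContDiff ℝ ∞ fun b : 𝔼 => (inner ℝ e b : ℝ) • e :=
      (contDiff_const.inner ℝ contDiff_id).smul contDiff_const
    exact h1.add (h2.contMDiff.comp_contMDiffOn (contMDiffOn_chartVel h.1))
  have hopen : IsOpen {v : TangentBundle (𝓡 n) M | v.proj ∈ φ.source} :=
    φ.open_source.preimage (FiberBundle.continuous_proj 𝔼 (TangentSpace (𝓡 n)))
  have ht0 : t (φ x) = 0 := (h.2.2 x hx).1 hxN
  have hq0 : q (φ x) = φ x := by simp only [q, ht0, zero_smul, sub_zero]
  have hz₀ : φ x ∈ O := by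
    change q (φ x) ∈ φ.target
    rw [hq0]
    exact φ.map_source hx
  have hσ0 : σ (φ x) = ⟨x, 0⟩ := by
    simp only [σ]
    rw [ht0, hq0, zero_smul, chartLift_zero]
    exact TangentBundle.ext_of_eq (φ.left_inv hx) rfl
  have hΨσ : ∀ z ∈ O, Ψ (Φ (σ z)) = σ z := fun z hz => hΨΦ (hσν hz)
  have hR : ContMDiffWithinAt (𝓡 n) (𝓡 n) ∞ (r ∘ Ψ) U (Φ (σ (φ x))) := by
    have h1 : ContMDiffAt (𝓡 n).tangent (𝓡 n) ∞ r (Ψ (Φ (σ (φ x)))) := by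
      rw [hΨσ _ hz₀]
      exact hr.contMDiffAt (hopen.mem_nhds (hσp _ hz₀))
    exact h1.comp_contMDiffWithinAt _ (hΨ _ (hΦU (hσν hz₀)))
  have key := mem_nhds_image_of_leftInverse hO (hΦ.comp hσ hσν)
    (fun z hz => hΦU (hσν hz)) hz₀ (hR.mdifferentiableWithinAt (by simp))
    (fun z hz => by
      change r (Ψ (Φ (σ z))) = z
      rw [hΨσ z hz, hrσ z hz])
  rw [Function.comp, hσ0] at key
  refine mem_of_superset key ?_
  rintro _ ⟨z, hz, rfl⟩
  exact ⟨σ z, ⟨hσν hz, hσp z hz⟩, rfl⟩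

end IsHypersurfaceChart

end Submanifolds

/-! ### Excluding codimension zero and one -/

section Complement

variable {n : ℕ} {M : Type*} [MetricSpace M] [ChartedSpace (EuclideanSpace ℝ (Fin n)) M]
  [RiemannianBundle (fun x : M => TangentSpace (𝓡 n) x)]

local notation "𝔼" => EuclideanSpace ℝ (Fin n)

theorem IsSubmanifoldAt.eq_zero_of_mem_normalBundle {N : Set M} {x : M}
    (h : IsSubmanifoldAt (n := n) N x n) {v : TangentSpace (𝓡 n) x}
    (hv : (⟨x, v⟩ : TangentBundle (𝓡 n) M) ∈ normalBundle n N) : v = 0 := by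
  obtain ⟨T, hT, hT'⟩ := h.exists_submodule hv.1
  have hE : Module.finrank ℝ (TangentSpace (𝓡 n) x) = n := finrank_euclideanSpace_fin
  have hfin : FiniteDimensional ℝ (TangentSpace (𝓡 n) x) :=
    inferInstanceAs (FiniteDimensional ℝ 𝔼)
  have htop : T = ⊤ := Submodule.eq_top_of_finrank_eq (hT.trans hE.symm)
  exact eq_zero_of_mem_normalBundle_of_mem_tangentVectors hv
    ((hT' v).1 (htop ▸ Submodule.mem_top))

variable [IsManifold (𝓡 n) ∞ M] {N P : Set M} {Φ : TangentBundle (𝓡 n) M → M}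
  {Ψ : M → TangentBundle (𝓡 n) M}

/-- If the complement of a nonempty set in a compact connected manifold is diffeomorphic to the
normal bundle of a submanifold, then that submanifold has no component of codimension zero. -/
theorem not_isSubmanifoldAt_of_diffeo [CompactSpace M] [PreconnectedSpace M] (hP : P.Nonempty)
    (hNclosed : IsClosed N) (hNsub : IsSmoothSubmanifold n N)
    (hΦ : ContMDiffOn (𝓡 n).tangent (𝓡 n) ∞ Φ (normalBundle n N))
    (hΨ : ContMDiffOn (𝓡 n) (𝓡 n).tangent ∞ Ψ Pᶜ)
    (hΦP : MapsTo Φ (normalBundle n N) Pᶜ) (hΨP : MapsTo Ψ Pᶜ (normalBundle n N))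
    (hinv : InvOn Ψ Φ (normalBundle n N) Pᶜ) {p : M} (hp : p ∈ N) :
    ¬ IsSubmanifoldAt (n := n) N p n := by
  intro hpn
  set S : Set M := {x | x ∈ N ∧ IsSubmanifoldAt (n := n) N x n} with hS
  have hSopen : IsOpen S := by
    refine isOpen_iff_mem_nhds.2 fun x hx => ?_
    obtain ⟨φ, hφ, hxφ, V, hVd, hV⟩ := hx.2
    have htop : V = ⊤ := Submodule.eq_top_of_finrank_eq (hVd.trans finrank_euclideanSpace_fin.symm)
    filter_upwards [φ.open_source.mem_nhds hxφ] with y hy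
    exact ⟨(hV y hy).2 (htop ▸ Submodule.mem_top), φ, hφ, hy, V, hVd, hV⟩
  have hSuniv : S = univ :=
    IsClopen.eq_univ ⟨hNsub.isClosed_setOf hNclosed n, hSopen⟩ ⟨p, hp, hpn⟩
  have hxS : ∀ x : M, x ∈ S := fun x => hSuniv ▸ mem_univ x
  set F : M → M := fun x => Φ ⟨x, 0⟩ with hF
  have hs : ContMDiff (𝓡 n) (𝓡 n).tangent ∞ (fun x : M => (⟨x, 0⟩ : TangentBundle (𝓡 n) M)) :=
    Bundle.contMDiff_zeroSection ℝ (TangentSpace (𝓡 n) : M → Type _)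
  have hFs : ContMDiff (𝓡 n) (𝓡 n) ∞ F :=
    contMDiffOn_univ.1 (hΦ.comp hs.contMDiffOn fun x _ => zero_mem_normalBundle (hxS x).1)
  have hFP : ∀ x, F x ∈ Pᶜ := fun x => hΦP (zero_mem_normalBundle (hxS x).1)
  have hΨF : ∀ x, Ψ (F x) = ⟨x, 0⟩ := fun x => hinv.1 (zero_mem_normalBundle (hxS x).1)
  -- All normal vectors vanish, so the zero section is the entire normal bundle.
  have hrange : range F = Pᶜ := by
    refine Subset.antisymm (range_subset_iff.2 hFP) fun u hu => ?_
    have h1 : (Ψ u).snd = 0 := (hxS (Ψ u).proj).2.eq_zero_of_mem_normalBundle (hΨP hu)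
    refine ⟨(Ψ u).proj, ?_⟩
    change Φ ⟨(Ψ u).proj, 0⟩ = u
    rw [← h1]
    exact hinv.2 hu
  -- In a chart of the source, `F` has the differentiable left inverse given by `Ψ` followed by the
  -- bundle projection.
  have hopen : IsOpen (range F) := by
    refine isOpen_iff_mem_nhds.2 ?_
    rintro _ ⟨x, rfl⟩
    set c := chartAt 𝔼 x
    have hx : x ∈ c.source := mem_chart_source 𝔼 x
    have hcA := IsManifold.chart_mem_maximalAtlas (I := 𝓡 n) (n := ∞) x
    have hR : ContMDiffWithinAt (𝓡 n) (𝓡 n) ∞ (fun u => c (Ψ u).proj) Pᶜ (F (c.symm (c x))) := by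
      have h1 : ContMDiffAt (𝓡 n) (𝓡 n) ∞ c (Ψ (F (c.symm (c x)))).proj := by
        rw [c.left_inv hx, hΨF]
        exact contMDiffAt_of_mem_maximalAtlas hcA hx
      have h2 : ContMDiffWithinAt (𝓡 n) (𝓡 n) ∞ (fun u => (Ψ u).proj) Pᶜ (F (c.symm (c x))) :=
        (Bundle.contMDiff_proj (TangentSpace (𝓡 n))).contMDiffAt.comp_contMDiffWithinAt
          (F (c.symm (c x))) (hΨ _ (hFP _))
      exact h1.comp_contMDiffWithinAt (F (c.symm (c x))) h2
    have key := mem_nhds_image_of_leftInverse c.open_target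
      (hFs.comp_contMDiffOn (contMDiffOn_symm_of_mem_maximalAtlas hcA)) (fun z _ => hFP _)
      (c.map_source hx) (hR.mdifferentiableWithinAt (by simp))
      (fun z hz => by
        change c (Ψ (F (c.symm z))).proj = z
        rw [hΨF]
        exact c.right_inv hz)
    rw [Function.comp, c.left_inv hx] at key
    refine mem_of_superset key ?_
    rintro _ ⟨z, -, rfl⟩
    exact mem_range_self _
  have huniv : range F = univ :=
    IsClopen.eq_univ ⟨(isCompact_range hFs.continuous).isClosed, hopen⟩ ⟨_, mem_range_self p⟩
  obtain ⟨y, hy⟩ := hP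
  have : y ∈ Pᶜ := hrange ▸ huniv ▸ mem_univ y
  exact this hy

variable [IsContMDiffRiemannianBundle (𝓡 n) ∞ (EuclideanSpace ℝ (Fin n))
    (fun x : M => TangentSpace (𝓡 n) x)]

/-- On a simply connected manifold, the image of the zero section over the hypersurface part `S` of
`N` is two-sided: some function `f` is locally constant off this image and changes sign on every
normal line. -/
theorem exists_side_function [SimplyConnectedSpace M] {d : ℕ} (hd : d + 1 = n) {S : Set M}
    (hS : S = {x | x ∈ N ∧ IsSubmanifoldAt (n := n) N x d})
    (hSclosed : IsClosed ((fun x : M => Φ ⟨x, 0⟩) '' S))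
    (hΦ : ContMDiffOn (𝓡 n).tangent (𝓡 n) ∞ Φ (normalBundle n N))
    (hΨ : ContMDiffOn (𝓡 n) (𝓡 n).tangent ∞ Ψ Pᶜ)
    (hΦP : MapsTo Φ (normalBundle n N) Pᶜ) (hΨP : MapsTo Ψ Pᶜ (normalBundle n N))
    (hinv : InvOn Ψ Φ (normalBundle n N) Pᶜ) :
    ∃ f : M → ℤˣ, ContinuousOn f ((fun x : M => Φ ⟨x, 0⟩) '' S)ᶜ ∧
      ∀ x ∈ S, ∃ k : TangentSpace (𝓡 n) x, k ≠ 0 ∧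
        (⟨x, k⟩ : TangentBundle (𝓡 n) M) ∈ normalBundle n N ∧
        ∃ c : ℤˣ, ∀ᶠ t : ℝ in 𝓝 0, t ≠ 0 → f (Φ ⟨x, t • k⟩) = c * signUnit t := by
  have hLPC : LocallyPathConnectedSpace M :=
    ChartedSpace.locallyPathConnectedSpace (EuclideanSpace ℝ (Fin n)) M
  have hchart : ∀ x : S, ∃ (φ : OpenPartialHomeomorph M 𝔼) (e : 𝔼), IsHypersurfaceChart N φ e ∧
      (x : M) ∈ φ.source ∧ ∀ y ∈ φ.source, IsSubmanifoldAt (n := n) N y d := fun x =>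
    (show (x : M) ∈ {x | x ∈ N ∧ IsSubmanifoldAt (n := n) N x d} from
      hS ▸ x.2).2.exists_isHypersurfaceChart hd
  choose φ e hφ hxφ hφd using hchart
  have hSN : ∀ x ∈ S, x ∈ N := fun x hx => by rw [hS] at hx; exact hx.1
  have hNS : ∀ (x : S) (y : M), y ∈ (φ x).source → y ∈ N → y ∈ S := fun x y hy hyN => by
    rw [hS]; exact ⟨hyN, hφd x y hy⟩
  choose k hkcont hk using fun x : S => (hφ x).exists_frame
  have hk0 : ∀ (x : S) (y : M), y ∈ (φ x).source → k x y ≠ 0 := by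
    intro x y hy h0
    have h1 := (hk x y hy).1
    rw [h0, conormal_zero] at h1
    exact zero_ne_one h1
  have hn : ∀ w : M, ∃ v : TangentSpace (𝓡 n) w, w ∈ S → v ≠ 0 ∧
      (⟨w, v⟩ : TangentBundle (𝓡 n) M) ∈ normalBundle n N := by
    intro w
    by_cases hw : w ∈ S
    · exact ⟨k ⟨w, hw⟩ w, fun _ => ⟨hk0 _ w (hxφ ⟨w, hw⟩), (hk _ w (hxφ ⟨w, hw⟩)).2 (hSN w hw)⟩⟩
    · exact ⟨0, fun h => absurd h hw⟩
  -- A nonzero normal vector at each point of `S`, with no continuity: it only serves to write the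
  -- orientation cocycle as a coboundary.
  choose ν hν using hn
  set Z : Set M := (fun x : M => Φ ⟨x, 0⟩) '' S with hZ
  let W : S → Set M := fun x => Φ '' (normalBundle n N ∩ {v | v.proj ∈ (φ x).source})
  have hW : ∀ x : S, W x ∈ 𝓝 (Φ ⟨(x : M), 0⟩) := fun x =>
    (hφ x).image_mem_nhds hΦ hΨ hΦP hinv.1 (hxφ x) (hSN x x.2)
  have hWu : ∀ x : S, ∀ u ∈ W x, u ∈ Pᶜ ∧ (Ψ u).proj ∈ (φ x).source ∧ (Ψ u).proj ∈ S := by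
    rintro x _ ⟨v, ⟨hv, hvs⟩, rfl⟩
    rw [hinv.1 hv]
    exact ⟨hΦP hv, hvs, hNS x _ hvs hv.1⟩
  have hne : ∀ (x : S) (w : M), w ∈ (φ x).source → w ∈ S →
      ∀ v : TangentSpace (𝓡 n) w, (⟨w, v⟩ : TangentBundle (𝓡 n) M) ∈ normalBundle n N → v ≠ 0 →
      conormal (φ x) (e x) ⟨w, v⟩ ≠ 0 := fun x w hw _ v hv hv0 h0 =>
    hv0 ((hφ x).eq_zero_of_conormal_eq_zero hw hv h0)
  -- The complement of `Z` together with neighborhoods of the points of `Z` on which the normal line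
  -- is framed. The sign for `none` compares `Ψ u` with `ν`, the sign for `some x` compares `ν` with
  -- the local conormal; the arbitrary choice of `ν` cancels in the products. Values of the `none`
  -- sign away from the sets `W x` do not matter.
  let U : Option S → Set M := fun i => i.elim Zᶜ fun x => interior (W x)
  let ε : Option S → M → ℤˣ := fun i u => i.elim
    (signUnit (inner ℝ (ν (Ψ u).proj) (Ψ u).snd))
    fun x => signUnit (conormal (φ x) (e x) ⟨(Ψ u).proj, ν (Ψ u).proj⟩)
  have hΨc : ContinuousOn Ψ Pᶜ := hΨ.continuousOn
  have hsn : ∀ x : S, ∀ u ∈ W x, u ∉ Z →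
      ε (some x) u * ε none u = signUnit (conormal (φ x) (e x) (Ψ u)) ∧
      conormal (φ x) (e x) (Ψ u) ≠ 0 := by
    intro x u hu huZ
    obtain ⟨huP, hws, hwS⟩ := hWu x u hu
    have hv : Ψ u ∈ normalBundle n N := hΨP huP
    have hΦu : Φ (Ψ u) = u := hinv.2 huP
    have hv0 : (Ψ u).snd ≠ 0 := by
      intro h0
      refine huZ ⟨(Ψ u).proj, hwS, ?_⟩
      change Φ ⟨(Ψ u).proj, 0⟩ = u
      rw [← h0]
      exact hΦu
    obtain ⟨hν0, hνν⟩ := hν _ hwS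
    have hτv : conormal (φ x) (e x) (Ψ u) ≠ 0 := hne x _ hws hwS _ hv hv0
    have hτν := hne x _ hws hwS _ hνν hν0
    -- Pairing this relation with `ν` shows that the sign of the conormal of `Ψ u` is the product of
    -- the two signs.
    have hline := (hφ x).conormal_smul_comm hws (v := (Ψ u).snd) hv hνν
    have hpos : 0 < inner ℝ (ν (Ψ u).proj) (ν (Ψ u).proj) := real_inner_self_pos.2 hν0
    have h1 := congrArg (fun w => inner ℝ (ν (Ψ u).proj) w) hline
    simp only [real_inner_smul_right] at h1
    have h2 : inner ℝ (ν (Ψ u).proj) (Ψ u).snd ≠ 0 := by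
      intro h0
      rw [h0, mul_zero] at h1
      exact (mul_ne_zero hτv hpos.ne') h1
    refine ⟨?_, hτv⟩
    change signUnit _ * signUnit _ = _
    rw [← signUnit_mul hτν h2, ← h1, signUnit_mul hτv hpos.ne', signUnit_of_pos hpos, mul_one]
  have hsnc : ∀ x : S, ContinuousOn (fun u => signUnit (conormal (φ x) (e x) (Ψ u)))
      (interior (W x) ∩ Zᶜ) := by
    intro x
    refine ContinuousOn.signUnit ?_ fun u hu => (hsn x u (interior_subset hu.1) hu.2).2
    exact (hφ x).continuousOn_conormal.comp
      (hΨc.mono fun u hu => (hWu x u (interior_subset hu.1)).1)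
      fun u hu => (hWu x u (interior_subset hu.1)).2.1
  obtain ⟨h, hh⟩ := exists_continuousOn_mul_of_simplyConnected U
    (fun i => by
      cases i with
      | none => exact hSclosed.isOpen_compl
      | some x => exact isOpen_interior)
    (fun u => by
      by_cases hu : u ∈ Z
      · obtain ⟨x, hx, rfl⟩ := hu
        exact ⟨some ⟨x, hx⟩, mem_interior_iff_mem_nhds.2 (hW ⟨x, hx⟩)⟩
      · exact ⟨none, hu⟩)
    ε
    (fun i j => by
      rcases i with _ | x <;> rcases j with _ | y
      · exact continuousOn_const.congr fun u _ => Int.units_mul_self _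
      · rw [inter_comm]
        refine (hsnc y).congr fun u hu => ?_
        exact (mul_comm _ _).trans (hsn y u (interior_subset hu.1) hu.2).1
      · exact (hsnc x).congr fun u hu => (hsn x u (interior_subset hu.1) hu.2).1
      -- Between two framed neighborhoods the transition sign is that of one conormal on the frame
      -- of the other, which is continuous and nonzero.
      · have hc : ∀ u ∈ interior (W x) ∩ interior (W y),
            conormal (φ y) (e y) ⟨(Ψ u).proj, k x (Ψ u).proj⟩ ≠ 0 ∧
            ε (some x) u * ε (some y) u =
              signUnit (conormal (φ y) (e y) ⟨(Ψ u).proj, k x (Ψ u).proj⟩) := by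
          intro u hu
          obtain ⟨huP, hws, hwS⟩ := hWu x u (interior_subset hu.1)
          have hws' := (hWu y u (interior_subset hu.2)).2.1
          obtain ⟨hν0, hνν⟩ := hν _ hwS
          have hkk := (hk x _ hws).2 (hSN _ hwS)
          have h1 := hne y _ hws' hwS _ hkk (hk0 x _ hws)
          have hτν := hne x _ hws hwS _ hνν hν0
          have hline := (hφ x).conormal_smul_comm hws hkk hνν
          rw [(hk x _ hws).1, one_smul] at hline
          refine ⟨h1, ?_⟩
          change signUnit (conormal (φ x) (e x) ⟨(Ψ u).proj, ν (Ψ u).proj⟩) *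
            signUnit (conormal (φ y) (e y) ⟨(Ψ u).proj, ν (Ψ u).proj⟩) = _
          have h2 : conormal (φ y) (e y) ⟨(Ψ u).proj, ν (Ψ u).proj⟩ =
              conormal (φ x) (e x) ⟨(Ψ u).proj, ν (Ψ u).proj⟩ *
                conormal (φ y) (e y) ⟨(Ψ u).proj, k x (Ψ u).proj⟩ := by
            rw [← conormal_smul, ← hline]
          rw [h2, signUnit_mul hτν h1, ← mul_assoc, Int.units_mul_self, one_mul]
        refine ContinuousOn.congr ?_ fun u hu => (hc u hu).2
        refine ContinuousOn.signUnit ?_ fun u hu => (hc u hu).1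
        have hp : ContinuousOn (fun u => (Ψ u).proj) (interior (W x) ∩ interior (W y)) :=
          (FiberBundle.continuous_proj 𝔼 (TangentSpace (𝓡 n))).comp_continuousOn
            (hΨc.mono fun u hu => (hWu x u (interior_subset hu.1)).1)
        have hkp := (hkcont x).comp hp fun u hu => (hWu x u (interior_subset hu.1)).2.1
        exact (hφ y).continuousOn_conormal.comp hkp
          fun u hu => (hWu y u (interior_subset hu.2)).2.1)
  -- Near a point of `Z`, `f` is the locally constant `h * ε (some x)` times the sign of the
  -- conormal of `Ψ u`. Along the normal line in direction `k`, this conormal is the parameter `t`.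
  refine ⟨fun u => h u * ε none u, hh none, fun x hx => ?_⟩
  set x' : S := ⟨x, hx⟩ with hx'
  have hkν := (hk x' x (hxφ x')).2 (hSN x hx)
  have hkx := (hk x' x (hxφ x')).1
  have hkx0 := hk0 x' x (hxφ x')
  refine ⟨k x' x, hkx0, hkν, h (Φ ⟨x, 0⟩) * ε (some x') (Φ ⟨x, 0⟩), ?_⟩
  let γ : ℝ → M := fun t => Φ ⟨x, t • k x' x⟩
  have hγν : ∀ t : ℝ, (⟨x, t • k x' x⟩ : TangentBundle (𝓡 n) M) ∈ normalBundle n N :=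
    fun t => smul_mem_normalBundle t hkν
  have hγ : Continuous γ := by
    refine hΦ.continuousOn.comp_continuous ?_ hγν
    exact (FiberBundle.continuous_totalSpaceMk 𝔼 (TangentSpace (𝓡 n)) x).comp
      (continuous_id.smul continuous_const)
  have hγ0 : γ 0 = Φ ⟨x, 0⟩ := by simp only [γ, zero_smul]
  have hint : ∀ᶠ t in 𝓝 (0 : ℝ), γ t ∈ interior (W x') := by
    refine hγ.continuousAt.eventually_mem (isOpen_interior.mem_nhds ?_)
    rw [hγ0]
    exact mem_interior_iff_mem_nhds.2 (hW x')
  have hconst : ∀ᶠ t in 𝓝 (0 : ℝ), h (γ t) * ε (some x') (γ t) = h (γ 0) * ε (some x') (γ 0) := by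
    have h1 : ContinuousAt (fun u => h u * ε (some x') u) (γ 0) :=
      (hh (some x')).continuousAt (isOpen_interior.mem_nhds hint.self_of_nhds)
    have h2 : ContinuousAt (fun t => h (γ t) * ε (some x') (γ t)) 0 :=
      ContinuousAt.comp (g := fun u => h u * ε (some x') u) h1 hγ.continuousAt
    exact h2.eventually_mem (isOpen_discrete {h (γ 0) * ε (some x') (γ 0)} |>.mem_nhds rfl)
  filter_upwards [hint, hconst] with t ht htc ht0
  have hΨγ : Ψ (γ t) = ⟨x, t • k x' x⟩ := hinv.1 (hγν t)
  have htZ : γ t ∉ Z := by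
    rintro ⟨y, hy, hyt⟩
    have h1 : (⟨y, 0⟩ : TangentBundle (𝓡 n) M) = ⟨x, t • k x' x⟩ :=
      hinv.1.injOn (zero_mem_normalBundle (hSN y hy)) (hγν t) hyt
    have h2 : conormal (φ x') (e x') (⟨y, 0⟩ : TangentBundle (𝓡 n) M) = t := by
      rw [h1, conormal_smul, hkx, mul_one]
    rw [conormal_zero] at h2
    exact ht0 h2.symm
  have h3 := (hsn x' (γ t) (interior_subset ht) htZ).1
  rw [hΨγ, conormal_smul, hkx, mul_one] at h3
  rw [← hγ0, ← htc, ← h3]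
  change h (γ t) * ε none (γ t) = _
  rw [mul_assoc, ← mul_assoc (ε (some x') (γ t)), Int.units_mul_self, one_mul]

/-- If the complement of a nonempty connected set in a compact simply connected manifold is
diffeomorphic to the normal bundle of a submanifold, then that submanifold has no component of
codimension one. -/
theorem not_isSubmanifoldAt_of_diffeo_of_simplyConnected [CompactSpace M] [SimplyConnectedSpace M]
    (hPconn : IsConnected P) (hNclosed : IsClosed N) (hNsub : IsSmoothSubmanifold n N)
    (hΦ : ContMDiffOn (𝓡 n).tangent (𝓡 n) ∞ Φ (normalBundle n N))
    (hΨ : ContMDiffOn (𝓡 n) (𝓡 n).tangent ∞ Ψ Pᶜ)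
    (hΦP : MapsTo Φ (normalBundle n N) Pᶜ) (hΨP : MapsTo Ψ Pᶜ (normalBundle n N))
    (hinv : InvOn Ψ Φ (normalBundle n N) Pᶜ) {p : M} (hp : p ∈ N) {d : ℕ} (hd : d + 1 = n) :
    ¬ IsSubmanifoldAt (n := n) N p d := by
  intro hpd
  set S : Set M := {x | x ∈ N ∧ IsSubmanifoldAt (n := n) N x d} with hS
  have hSc : IsClosed S := hNsub.isClosed_setOf hNclosed d
  set Z : Set M := (fun x : M => Φ ⟨x, 0⟩) '' S with hZ
  have hZc : IsClosed Z := by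
    refine (hSc.isCompact.image_of_continuousOn ?_).isClosed
    exact hΦ.continuousOn.comp continuous_zero_tangentVector.continuousOn
      fun x hx => zero_mem_normalBundle hx.1
  obtain ⟨f, hf, hfS⟩ := exists_side_function hd hS hZc hΦ hΨ hΦP hΨP hinv
  have hZP : Z ⊆ Pᶜ := by
    rintro _ ⟨x, hx, rfl⟩
    exact hΦP (zero_mem_normalBundle hx.1)
  obtain ⟨y₀, hy₀⟩ := hPconn.nonempty
  have hfP : ∀ y ∈ P, f y = f y₀ := fun y hy =>
    hPconn.isPreconnected.constant (hf.mono fun z hz hzZ => hZP hzZ hz) hy hy₀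
  have hΨc : ContinuousOn Ψ Pᶜ := hΨ.continuousOn
  -- `Z` and the points over `S` on the side of `Z` that `P` avoids.
  set K : Set M := {u | u ∈ Pᶜ ∧ (Ψ u).proj ∈ S ∧ (u ∈ Z ∨ f u = -f y₀)} with hK
  have hZK : Z ⊆ K := by
    rintro _ ⟨x, hx, rfl⟩
    refine ⟨hΦP (zero_mem_normalBundle hx.1), ?_, Or.inl ⟨x, hx, rfl⟩⟩
    change (Ψ (Φ ⟨x, 0⟩)).proj ∈ S
    rw [hinv.1 (zero_mem_normalBundle hx.1)]
    exact hx
  have hKc : IsClosed K := by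
    refine isClosed_of_closure_subset fun u hu => ?_
    by_cases huZ : u ∈ Z
    · exact hZK huZ
    have hfu : ∀ᶠ z in 𝓝 u, z ∉ Z ∧ f z = f u := by
      refine Eventually.and (hZc.isOpen_compl.mem_nhds huZ) ?_
      exact (hf.continuousAt (hZc.isOpen_compl.mem_nhds huZ)).eventually_mem
        ((isOpen_discrete {f u}).mem_nhds rfl)
    have hfu' : f u = -f y₀ := by
      obtain ⟨z, hzK, hzZ, hzf⟩ := ((mem_closure_iff_frequently.1 hu).and_eventually hfu).exists
      rw [← hzf]
      exact hzK.2.2.resolve_left hzZ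
    -- The crucial point of closedness: `f` has the opposite sign on `P`, so a limit off `Z` cannot
    -- lie in `P`, and `Ψ` remains usable there.
    have huP : u ∈ Pᶜ := by
      intro huP
      rw [hfP u huP] at hfu'
      exact units_ne_neg_self (f y₀) hfu'
    refine ⟨huP, ?_, Or.inr hfu'⟩
    have hcont : ContinuousWithinAt (fun z => (Ψ z).proj) K u :=
      (FiberBundle.continuous_proj 𝔼 (TangentSpace (𝓡 n))).continuousAt.comp_continuousWithinAt
        ((hΨc u huP).mono fun z hz => hz.1)
    exact hSc.closure_subset (hcont.mem_closure hu fun z hz => hz.2.1)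
  obtain ⟨C, hC⟩ : ∃ C : ℝ, ∀ u ∈ K, inner ℝ (Ψ u).snd (Ψ u).snd ≤ C := by
    have h1 : ContinuousOn (fun u => inner ℝ (Ψ u).snd (Ψ u).snd) K := by
      have h2 : ContMDiffOn (𝓡 n) (𝓡 n).tangent ∞
          (fun u => (⟨(Ψ u).proj, (Ψ u).snd⟩ : TangentBundle (𝓡 n) M)) K :=
        hΨ.mono fun z hz => hz.1
      exact (h2.inner_bundle h2).continuousOn
    obtain ⟨C, hC⟩ := (hKc.isCompact.image_of_continuousOn h1).bddAbove
    exact ⟨C, fun u hu => hC (mem_image_of_mem _ hu)⟩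
  obtain ⟨k, hk0, hkν, c, hc⟩ := hfS p ⟨hp, hpd⟩
  have hγν : ∀ t : ℝ, (⟨p, t • k⟩ : TangentBundle (𝓡 n) M) ∈ normalBundle n N :=
    fun t => smul_mem_normalBundle t hkν
  have hγ : Continuous fun t : ℝ => Φ ⟨p, t • k⟩ := by
    refine hΦ.continuousOn.comp_continuous ?_ hγν
    exact (FiberBundle.continuous_totalSpaceMk 𝔼 (TangentSpace (𝓡 n)) p).comp
      (continuous_id.smul continuous_const)
  have hγZ : ∀ t : ℝ, t ≠ 0 → Φ ⟨p, t • k⟩ ∉ Z := by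
    rintro t ht ⟨y, hy, hyt⟩
    have h1 : (⟨y, 0⟩ : TangentBundle (𝓡 n) M) = ⟨p, t • k⟩ :=
      hinv.1.injOn (zero_mem_normalBundle hy.1) (hγν t) hyt
    obtain rfl : y = p := congrArg TotalSpace.proj h1
    injection h1 with _ h2
    exact (smul_ne_zero ht hk0) h2.symm
  -- Each open half of a normal line misses `Z`, so `f` is constant on it, with the value known near
  -- zero. The two halves have opposite signs; `a = ±1` selects the one inside `K`.
  obtain ⟨a, ha0, ha⟩ : ∃ a : ℝ, a ≠ 0 ∧ ∀ t > 0, f (Φ ⟨p, (t * a) • k⟩) = -f y₀ := by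
    have hside : ∀ a : ℝ, a ≠ 0 → ∀ t > 0, f (Φ ⟨p, (t * a) • k⟩) = c * signUnit a := by
      intro a ha t ht
      have h1 : ContinuousOn (fun t : ℝ => f (Φ ⟨p, (t * a) • k⟩)) (Ioi 0) := by
        refine hf.comp (hγ.comp (continuous_id.mul continuous_const)).continuousOn ?_
        exact fun s hs => hγZ _ (mul_ne_zero (ne_of_gt hs) ha)
      have h2 : Tendsto (fun t : ℝ => t * a) (𝓝[>] 0) (𝓝 0) := by
        have : Tendsto (fun t : ℝ => t * a) (𝓝 0) (𝓝 (0 * a)) :=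
          (continuous_id.mul continuous_const).tendsto 0
        rw [zero_mul] at this
        exact this.mono_left nhdsWithin_le_nhds
      obtain ⟨s, hs, hs0⟩ := ((h2.eventually hc).and self_mem_nhdsWithin).exists
      have hs0' : 0 < s := hs0
      have h3 := hs (mul_ne_zero hs0'.ne' ha)
      rw [signUnit_mul hs0'.ne' ha, signUnit_of_pos hs0', one_mul] at h3
      rw [← h3]
      exact isPreconnected_Ioi.constant h1 ht hs0
    by_cases hcy : c = -f y₀
    · refine ⟨1, one_ne_zero, fun t ht => ?_⟩
      rw [hside 1 one_ne_zero t ht, signUnit_of_pos one_pos, mul_one, hcy]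
    · refine ⟨-1, by norm_num, fun t ht => ?_⟩
      rw [hside (-1) (by norm_num) t ht, signUnit_of_neg (by norm_num), mul_neg_one,
        Int.units_ne_iff_eq_neg.1 hcy, neg_neg]
  have hbound : ∀ t > 0, (t * a) ^ 2 * inner ℝ k k ≤ C := by
    intro t ht
    have hΨt : Ψ (Φ ⟨p, (t * a) • k⟩) = ⟨p, (t * a) • k⟩ := hinv.1 (hγν _)
    have h1 := hC (Φ ⟨p, (t * a) • k⟩) ⟨hΦP (hγν _), by rw [hΨt]; exact ⟨hp, hpd⟩, Or.inr (ha t ht)⟩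
    rw [hΨt] at h1
    change inner ℝ ((t * a) • k) ((t * a) • k) ≤ C at h1
    rw [real_inner_smul_left, real_inner_smul_right] at h1
    linarith
  have hpos : 0 < a ^ 2 * inner ℝ k k := mul_pos (by positivity) (real_inner_self_pos.2 hk0)
  -- At time `m + 1`, positive even for `m = 0`, the squared norm exceeds `C` because `(m + 1) ^ 2 ≥
  -- m`.
  obtain ⟨m, hm⟩ := exists_nat_gt (C / (a ^ 2 * inner ℝ k k))
  rw [div_lt_iff₀ hpos] at hm
  have h1 := hbound (m + 1) (by positivity)
  have hm0 : (0 : ℝ) ≤ m := m.cast_nonneg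
  nlinarith [mul_nonneg hm0 hpos.le, mul_nonneg (mul_nonneg hm0 hm0) hpos.le]

end Complement

theorem mainTheorem12 {n k : ℕ} {M G : Type*}
    [MetricSpace M] [ChartedSpace (EuclideanSpace ℝ (Fin n)) M] [IsManifold (𝓡 n) ∞ M]
    [RiemannianBundle (fun x : M => TangentSpace (𝓡 n) x)]
    [IsContMDiffRiemannianBundle (𝓡 n) ∞ (EuclideanSpace ℝ (Fin n))
      (fun x : M => TangentSpace (𝓡 n) x)]
    [IsRiemannianManifold (𝓡 n) M]
    [CompactSpace M] [SimplyConnectedSpace M]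
    (hcurv : NonnegativelyCurved n M)
    [Group G] [TopologicalSpace G] [ChartedSpace (EuclideanSpace ℝ (Fin k)) G]
    [LieGroup (𝓡 k) ∞ G] [T2Space G] [CompactSpace G] [ConnectedSpace G]
    [MulAction G M] [ContinuousSMul G M] [ContMDiffSMul (𝓡 k) (𝓡 n) ∞ G M]
    [IsIsometricSMul G M]
    (hbdry : (alexandrovBoundary (OrbitSpace G M)).Nonempty)
    (B : Set (OrbitSpace G M)) (hB : IsBoundaryStratum B) (hBconn : IsConnected B)
    (hBsub : IsSmoothSubmanifold n (OrbitSpace.proj G ⁻¹' B : Set M))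
    (N : Set M) (hNclosed : IsClosed N) (hNsub : IsSmoothSubmanifold n N)
    (hNinv : ∀ g : G, ∀ p ∈ N, g • p ∈ N)
    (hN : EquivDiffeoNormalBundle n G (OrbitSpace.proj G ⁻¹' B)ᶜ N) :
    CodimAtLeast n N 2 := by
  obtain ⟨Φ, Ψ, hΦ, hΨ, hΦP, hΨP, hinv, -⟩ := hN
  have hPconn : IsConnected (OrbitSpace.proj G ⁻¹' B : Set M) := by
    obtain ⟨b, hb⟩ := hBconn.nonempty
    obtain ⟨x, rfl⟩ := Quotient.exists_rep b
    exact ⟨⟨x, hb⟩, OrbitSpace.isPreconnected_preimage_proj hBconn.isPreconnected⟩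
  intro p hp
  obtain ⟨d, hd⟩ := hNsub p hp
  refine ⟨d, hd, ?_⟩
  have hdn : d ≠ n := by
    rintro rfl
    exact not_isSubmanifoldAt_of_diffeo hPconn.nonempty hNclosed hNsub hΦ hΨ hΦP hΨP hinv hp hd
  have hdn' : d + 1 ≠ n := fun h =>
    not_isSubmanifoldAt_of_diffeo_of_simplyConnected hPconn hNclosed hNsub hΦ hΨ hΦP hΨP hinv hp h
      hd
  have := hd.le
  omega
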